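/- **Setting.** Let $A$ be a real $N\times M$ matrix of rank $N$ in reduced row echelon form all of whose maximal minors $\Delta_I(A)$ are nonnegative (a point of $\mathrm{Gr}(N,M)_{\ge 0}$). Let $I_0$ be the lexicographically minimal $N$-subset $I\subset\{1,\dots,M\}$ with $\Delta_I(A)\neq 0$, and let $P_1(A)$ be the set of pairs $[i,j]$ such that $I_0\setminus J=\{i\}$ and $J\setminus I_0=\{j\}$ for some $N$-subset $J$ with $\Delta_J(A)\ne 0$. Let $\kappa_1<\dots<\kappa_M$ be real, and for each $[i,j]\in P_1(A)$ let $\kappa_{i,j},\kappa_{j,i}$ be real numbers such that $\kappa_k<\kappa_{k,\bullet}<\kappa_l<\kappa_{l,\bullet}$ for all $k<l$ and $\kappa_{k,p}<\kappa_{k,q}$ for $p>q$, and let $0<\mu_{i,j}=\mu_{j,i}<1$. Let $\gamma_{[i,j]}\in PSL_2(\mathbb R)$ be given by $$\frac{\gamma_{[i,j]}(z)-\kappa_{i,j}}{\gamma_{[i,j]}(z)-\kappa_{j,i}}=\mu_{i,j}\,\frac{z-\kappa_{i,j}}{z-\kappa_{j,i}},$$ let $\Gamma_A\subset PSL_2(\mathbb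 R)$ be the group generated by all $\gamma_{[i,j]}$, $[i,j]\in P_1(A)$, and let $\Omega(\Gamma_A)\subset\mathbb{CP}^1$ be its set of discontinuity. The isometric circle of $\gamma=\begin{pmatrix}a&b\\c&d\end{pmatrix}$ (with $ad-bc=1$, $c\neq 0$) is $I(\gamma)=\{z:|cz+d|=1\}$. Assume that the $\mu_{i,j}$ are so small that the closed discs bounded by the $2|P_1(A)|$ circles $I(\gamma_{[i,j]})$, $I(\gamma_{[i,j]}^{-1})$ are pairwise disjoint. For $[k,l]\in P_1(A)$ put $$\omega_{[k,l]}=\frac{dz}{2\pi i}\sum_{\gamma\in\Gamma_A/\langle\gamma_{[k,l]}\rangle}\left(\frac1{z-\gamma(\kappa_{k,l})}-\frac1{z-\gamma(\kappa_{l,k})}\right).$$ The cycle $a_{[i,j]}$ is the circle $I(\gamma_{[i,j]}^{-1})$ (around $\kappa_{i,j}$) counterclockwise, or, equivalently, the circle $I(\gamma_{[i,j]})$ (around $\kappa_{j,i}$) clockwise. The cycle $b_{[i,j]}$ is represented by any piecewise $C^1$ path in $\Omega(\Gamma_A)\cap\mathbb C$ from a point $a$ to $\gamma_{[i,j]}(a)$;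 such representatives differ by $a$-cycles up to homology on $\Omega(\Gamma_A)/\Gamma_A$. Write $$[\kappa_{i,j},\kappa_{j,i};\gamma(\kappa_{k,l}),\gamma(\kappa_{l,k})]=\frac{(\kappa_{i,j}-\gamma(\kappa_{k,l}))(\kappa_{j,i}-\gamma(\kappa_{l,k}))}{(\kappa_{i,j}-\gamma(\kappa_{l,k}))(\kappa_{j,i}-\gamma(\kappa_{k,l}))},$$ except that this symbol denotes $\mu_{i,j}$ when $[i,j]=[k,l]$ and $\gamma\in\langle\gamma_{[i,j]}\rangle$. Let $\ln$ be the principal logarithm, with $\ln x=\ln|x|+\pi i$ for $x<0$. **Proposition.** Let $[i,j],[k,l]\in P_1(A)$. 1. The series for $\omega_{[k,l]}$ converges absolutely at every point of $\Omega(\Gamma_A)\cap\mathbb C$, its sum is holomorphic there, and the circles $I(\gamma_{[i,j]}^{\pm1})$ lie in $\Omega(\Gamma_A)$. 2. $\displaystyle\oint_{a_{[i,j]}}\omega_{[k,l]}=1$ if $[i,j]=[k,l]$, and $=0$ if $[i,j]\neq[k,l]$. 3. For every system of representatives $\gamma$ of the double cosets $\langle\gamma_{[i,j]}\rangle\backslash\Gamma_A/\langle\gamma_{[k,l]}\rangle$,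 the series $$S=\frac1{2\pi i}\sum_{\gamma\in\langle\gamma_{[i,j]}\rangle\backslash\Gamma_A/\langle\gamma_{[k,l]}\rangle}\ln\,[\kappa_{i,j},\kappa_{j,i};\gamma(\kappa_{k,l}),\gamma(\kappa_{l,k})]$$ converges absolutely, and $\displaystyle\oint_{b_{[i,j]}}\omega_{[k,l]}\equiv S \pmod{\mathbb Z}$ for every path representing $b_{[i,j]}$. If the path lies in the upper half-plane, then $\displaystyle\oint_{b_{[i,j]}}\omega_{[k,l]}=S$ exactly, except that it equals $S-1$ when $\kappa_{k,l}<\kappa_{i,j}<\kappa_{l,k}<\kappa_{j,i}$. -/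

import Mathlib

open Complex Set Topology MeasureTheory
open scoped Real

noncomputable section

namespace KPSchottky

/-! ### The totally nonnegative Grassmannian and the set `P₁(A)` -/

variable {N M : ℕ}

/-- The maximal minor `Δ_I(A)` on the columns of an `N`-element set `I`, in increasing order. -/
def maxMinor (A : Matrix (Fin N) (Fin M) ℝ) (I : Finset (Fin M)) (h : I.card = N) : ℝ :=
  (A.submatrix id (I.orderEmbOfFin h)).det

/-- `A` is a full-rank matrix in reduced row echelon form. -/
def IsRREF (A : Matrix (Fin N) (Fin M) ℝ) : Prop :=
  ∃ piv : Fin N → Fin M, StrictMono piv ∧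
    (∀ k, A k (piv k) = 1) ∧ (∀ k l, l ≠ k → A l (piv k) = 0) ∧
    (∀ k j, j < piv k → A k j = 0)

/-- `A` represents (in reduced row echelon form) a point of `Gr(N, M)_{≥ 0}`. -/
structure IsTNN (A : Matrix (Fin N) (Fin M) ℝ) : Prop where
  rref : IsRREF A
  minor_nonneg : ∀ (I : Finset (Fin M)) (h : I.card = N), 0 ≤ maxMinor A I h

/-- The matroid of `A`: the `N`-element column sets with nonzero minor. -/
def matroid (A : Matrix (Fin N) (Fin M) ℝ) : Set (Finset (Fin M)) :=
  {I | ∃ h : I.card = N, maxMinor A I h ≠ 0}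

/-- `I₀` is the lexicographically minimal element of the matroid of `A`: when `I₀` and another
element `J` are listed increasingly, the first entry where they differ is smaller for `I₀`.
That entry is an element of `I₀ \ J` smaller than every element of `J \ I₀`. -/
def IsLexMin (A : Matrix (Fin N) (Fin M) ℝ) (I₀ : Finset (Fin M)) : Prop :=
  I₀ ∈ matroid A ∧ ∀ J ∈ matroid A, J ≠ I₀ → ∃ i ∈ I₀ \ J, ∀ j ∈ J \ I₀, i < j

/-- `P₁(A)`: the pairs `[i, j]` with `I₀ \ J = {i}` and `J \ I₀ = {j}` for some `J` in the
matroid, where `I₀` is its lexicographically minimal element. -/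
def P₁ (A : Matrix (Fin N) (Fin M) ℝ) : Set (Fin M × Fin M) :=
  {p | ∃ I₀ J, IsLexMin A I₀ ∧ J ∈ matroid A ∧ I₀ \ J = {p.1} ∧ J \ I₀ = {p.2}}

lemma P₁_lt {A : Matrix (Fin N) (Fin M) ℝ} {p : Fin M × Fin M} (hp : p ∈ P₁ A) : p.1 < p.2 := by
  obtain ⟨I₀, J, hI, hJ, h1, h2⟩ := hp
  have hne : J ≠ I₀ := by
    rintro rfl
    simp at h1
  obtain ⟨i, hi, hlt⟩ := hI.2 J hJ hne
  rw [h1, Finset.mem_singleton] at hi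
  subst hi
  exact hlt _ (by rw [h2]; exact Finset.mem_singleton_self _)

/-- `κ_{k,p}` is one of the parameters, i.e. `[k, p]` or `[p, k]` belongs to `P₁(A)`. -/
def Linked (A : Matrix (Fin N) (Fin M) ℝ) (k p : Fin M) : Prop :=
  (k, p) ∈ P₁ A ∨ (p, k) ∈ P₁ A

/-- The Schottky parameters attached to `A`: the soliton parameters `κ_k`, the fixed points
`κ_{i,j}, κ_{j,i}` and the multipliers `μ_{i,j}`. The values of `fix` and `mu` away from `P₁(A)`
play no role. -/
structure Params (A : Matrix (Fin N) (Fin M) ℝ) where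
  kap : Fin M → ℝ
  kap_strictMono : StrictMono kap
  fix : Fin M → Fin M → ℝ
  kap_lt_fix : ∀ k p, Linked A k p → kap k < fix k p
  fix_lt_kap : ∀ k l p, k < l → Linked A k p → fix k p < kap l
  fix_lt_fix : ∀ k p q, q < p → Linked A k p → Linked A k q → fix k p < fix k q
  mu : Fin M → Fin M → ℝ
  mu_symm : ∀ i j, mu i j = mu j i
  mu_pos : ∀ p ∈ P₁ A, 0 < mu p.1 p.2
  mu_lt_one : ∀ p ∈ P₁ A, mu p.1 p.2 < 1

/-! ### Möbius transformations of the Riemann sphere -/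

/-- `PSL₂(ℝ)`. -/
abbrev PSL2R : Type := Matrix.ProjectiveSpecialLinearGroup (Fin 2) ℝ

/-- `SL₂(ℝ)` inside `GL₂(ℂ)`. -/
def toGLC : Matrix.SpecialLinearGroup (Fin 2) ℝ →* GL (Fin 2) ℂ :=
  (Matrix.GeneralLinearGroup.map Complex.ofRealHom).comp Matrix.SpecialLinearGroup.toGL

lemma toGLC_apply (g : Matrix.SpecialLinearGroup (Fin 2) ℝ) (i j : Fin 2) :
    (toGLC g) i j = ((g i j : ℝ) : ℂ) := rfl

/-- The action of `SL₂(ℝ)` on the Riemann sphere `ℂ ∪ {∞}` by `z ↦ (a z + b) / (c z + d)`. -/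
def moebiusSL : Matrix.SpecialLinearGroup (Fin 2) ℝ →* Equiv.Perm (OnePoint ℂ) :=
  (MulAction.toPermHom (GL (Fin 2) ℂ) (OnePoint ℂ)).comp toGLC

lemma moebiusSL_center (g : Matrix.SpecialLinearGroup (Fin 2) ℝ)
    (hg : g ∈ Subgroup.center (Matrix.SpecialLinearGroup (Fin 2) ℝ)) : moebiusSL g = 1 := by
  obtain ⟨r, hr, hs⟩ := Matrix.SpecialLinearGroup.mem_center_iff.mp hg
  have h00 : g 0 0 = r := by rw [← hs]; simp
  have h11 : g 1 1 = r := by rw [← hs]; simp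
  have h01 : g 0 1 = 0 := by rw [← hs]; simp
  have h10 : g 1 0 = 0 := by rw [← hs]; simp
  have hr0 : r ≠ 0 := by
    rintro rfl
    simp at hr
  have hrc : (r : ℂ) ≠ 0 := by exact_mod_cast hr0
  ext z
  change toGLC g • z = z
  cases z with
  | infty => simp [OnePoint.smul_infty_eq_ite, toGLC_apply, h10]
  | coe z => simp [OnePoint.smul_some_eq_ite, toGLC_apply, h00, h11, h01, h10, hrc]

/-- The action of `PSL₂(ℝ)` on the Riemann sphere by Möbius transformations. -/
def moebius : PSL2R →* Equiv.Perm (OnePoint ℂ) :=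
  QuotientGroup.lift _ moebiusSL moebiusSL_center

/-- Centre of the isometric circle `|c z + d| = 1` of a matrix with last row `(c, d)`, `c ≠ 0`. -/
def isoCenter (g : Matrix.SpecialLinearGroup (Fin 2) ℝ) : ℂ := ((-(g 1 1) / g 1 0 : ℝ) : ℂ)

/-- Radius of the isometric circle `|c z + d| = 1`. -/
def isoRadius (g : Matrix.SpecialLinearGroup (Fin 2) ℝ) : ℝ := |g 1 0|⁻¹

lemma mem_sphere_iso_iff (g : Matrix.SpecialLinearGroup (Fin 2) ℝ) (hc : g 1 0 ≠ 0) (z : ℂ) :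
    z ∈ Metric.sphere (isoCenter g) (isoRadius g) ↔ ‖(g 1 0 : ℂ) * z + (g 1 1 : ℂ)‖ = 1 := by
  have hcc : ((g 1 0 : ℝ) : ℂ) ≠ 0 := by exact_mod_cast hc
  have h : ((g 1 0 : ℝ) : ℂ) * z + ((g 1 1 : ℝ) : ℂ) = (g 1 0 : ℂ) * (z - isoCenter g) := by
    unfold isoCenter
    push_cast
    field_simp
    ring
  rw [h, norm_mul, mem_sphere_iff_norm, isoRadius, Complex.norm_real, Real.norm_eq_abs]
  have := abs_pos.mpr hc
  rw [mul_comm, ← eq_div_iff this.ne', one_div]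

/-! ### The set of discontinuity -/

/-- The set of discontinuity `Ω(Γ)` of a group of Möbius transformations. -/
def discontinuitySet (Γ : Subgroup PSL2R) : Set (OnePoint ℂ) :=
  {z | ∃ U ∈ 𝓝 z, {γ : PSL2R | γ ∈ Γ ∧ ((moebius γ '' U) ∩ U).Nonempty}.Finite}

/-- The function `z ↦ 1 / (z - p)` for a point `p` of the sphere; it is `0` for `p = ∞`. -/
def poleTerm (p : OnePoint ℂ) (z : ℂ) : ℂ := p.elim 0 fun a => 1 / (z - a)

/-- The factor `a - b` of a cross ratio; a factor containing `∞` is omitted, as usual. -/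
def crossFactor (a b : OnePoint ℂ) : ℂ := a.elim 1 fun x => b.elim 1 fun y => x - y

/-- The cross ratio `[a, b; c, d] = (a - c)(b - d) / ((a - d)(b - c))`. -/
def crossRatio (a b c d : OnePoint ℂ) : ℂ :=
  (crossFactor a c * crossFactor b d) / (crossFactor a d * crossFactor b c)

/-- A path `β : [0, 1] → ℂ` along which one can integrate: continuous, differentiable off a finite
set, with integrable derivative. All piecewise `C¹` paths are of this kind. -/
structure IsIntegrationPath (β : ℝ → ℂ) : Prop where
  continuousOn : ContinuousOn β (Icc 0 1)
  differentiable : ∃ S : Set ℝ, S.Finite ∧ ∀ t ∈ Ioo (0 : ℝ) 1 \ S, DifferentiableAt ℝ β t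
  integrable : IntervalIntegrable (deriv β) volume 0 1

/-- The integral of `f(z) dz` along `β : [0, 1] → ℂ`. -/
def pathIntegral (f : ℂ → ℂ) (β : ℝ → ℂ) : ℂ := ∫ t in (0 : ℝ)..1, f (β t) * deriv β t

namespace Params

variable {A : Matrix (Fin N) (Fin M) ℝ} (D : Params A)

/-- `κ_{i,j}` for `p = [i, j]`: the attractive fixed point of `γ_{[i,j]}`. -/
def attr (p : P₁ A) : ℝ := D.fix p.1.1 p.1.2

/-- `κ_{j,i}` for `p = [i, j]`: the repulsive fixed point of `γ_{[i,j]}`. -/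
def rep (p : P₁ A) : ℝ := D.fix p.1.2 p.1.1

/-- The multiplier `μ_{i,j}` for `p = [i, j]`. -/
def mult (p : P₁ A) : ℝ := D.mu p.1.1 p.1.2

lemma attr_lt_rep (p : P₁ A) : D.attr p < D.rep p :=
  (D.fix_lt_kap _ _ _ (P₁_lt p.2) (Or.inl p.2)).trans (D.kap_lt_fix _ _ (Or.inr p.2))

/-- The matrix of `γ_{[i,j]}`. -/
def genMatrix (p : P₁ A) : Matrix (Fin 2) (Fin 2) ℝ :=
  (1 / ((D.attr p - D.rep p) * √(D.mult p))) •
    !![D.attr p - D.mult p * D.rep p, -(D.attr p * D.rep p * (1 - D.mult p));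
       1 - D.mult p, -(D.rep p - D.mult p * D.attr p)]

lemma det_genMatrix (p : P₁ A) : (D.genMatrix p).det = 1 := by
  have h1 : D.attr p - D.rep p ≠ 0 := (sub_neg.mpr (D.attr_lt_rep p)).ne
  have hpos : 0 < D.mult p := D.mu_pos _ p.2
  have h2 : √(D.mult p) ≠ 0 := (Real.sqrt_pos.mpr hpos).ne'
  have h3 : √(D.mult p) ^ 2 = D.mult p := Real.sq_sqrt hpos.le
  rw [genMatrix, Matrix.det_smul, Matrix.det_fin_two_of, Fintype.card_fin, div_pow, mul_pow, h3]
  field_simp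
  ring

/-- The hyperbolic element `γ_{[i,j]}` as an element of `SL₂(ℝ)`. -/
def genSL (p : P₁ A) : Matrix.SpecialLinearGroup (Fin 2) ℝ := ⟨D.genMatrix p, D.det_genMatrix p⟩

/-- The hyperbolic element `γ_{[i,j]}` of `PSL₂(ℝ)`. -/
def gen (p : P₁ A) : PSL2R := QuotientGroup.mk (D.genSL p)

/-- The Schottky group `Γ_A` generated by the `γ_{[i,j]}`. -/
def Gam : Subgroup PSL2R := Subgroup.closure (Set.range D.gen)

/-- `γ_{[i,j]}` as an element of `Γ_A`. -/
def genG (p : P₁ A) : D.Gam := ⟨D.gen p, Subgroup.subset_closure ⟨p, rfl⟩⟩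

/-- The cyclic subgroup `⟨γ_{[i,j]}⟩` of `Γ_A`. -/
def cyc (p : P₁ A) : Subgroup D.Gam := Subgroup.zpowers (D.genG p)

/-- The attractive fixed point as a point of the sphere. -/
def attrPt (p : P₁ A) : OnePoint ℂ := ((D.attr p : ℂ) : OnePoint ℂ)

/-- The repulsive fixed point as a point of the sphere. -/
def repPt (p : P₁ A) : OnePoint ℂ := ((D.rep p : ℂ) : OnePoint ℂ)

/-- The `2g` closed discs bounded by the isometric circles `I(γ_{[i,j]})` (label `true`) and
`I(γ_{[i,j]}⁻¹)` (label `false`). -/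
def isoDisc : P₁ A × Bool → Set ℂ
  | (p, true) => Metric.closedBall (isoCenter (D.genSL p)) (isoRadius (D.genSL p))
  | (p, false) => Metric.closedBall (isoCenter ((D.genSL p)⁻¹)) (isoRadius ((D.genSL p)⁻¹))

/-- The closed discs bounded by the isometric circles are pairwise disjoint. -/
def DisjointIsometricCircles : Prop := Pairwise (Function.onFun Disjoint D.isoDisc)

lemma genSL_entry (p : P₁ A) (i j : Fin 2) : (D.genSL p) i j = D.genMatrix p i j := rfl

/-- `γ_{[i,j]}` is the Möbius transformation
`(γ(z) - κ_{i,j}) / (γ(z) - κ_{j,i}) = μ_{i,j} (z - κ_{i,j}) / (z - κ_{j,i})`. -/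
lemma gen_relation (p : P₁ A) (z w : ℂ) (h : moebius (D.gen p) (z : OnePoint ℂ) = w) :
    (w - D.attr p) * (z - D.rep p) = D.mult p * (z - D.attr p) * (w - D.rep p) := by
  have h1 : (D.attr p : ℂ) - D.rep p ≠ 0 := by
    exact_mod_cast (sub_neg.mpr (D.attr_lt_rep p)).ne
  have hpos : 0 < D.mult p := D.mu_pos _ p.2
  have h2 : ((√(D.mult p) : ℝ) : ℂ) ≠ 0 := by exact_mod_cast (Real.sqrt_pos.mpr hpos).ne'
  change toGLC (D.genSL p) • (z : OnePoint ℂ) = w at h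
  rw [OnePoint.smul_some_eq_ite] at h
  split_ifs at h with hz
  · exact absurd h (OnePoint.infty_ne_coe w)
  · rw [OnePoint.coe_eq_coe, div_eq_iff hz] at h
    simp only [toGLC_apply, genSL_entry, genMatrix] at h
    simp at h
    field_simp at h
    linear_combination -h

lemma gen_attrPt (p : P₁ A) : moebius (D.gen p) (D.attrPt p) = D.attrPt p := by
  have h1 : (D.attr p : ℂ) - D.rep p ≠ 0 := by
    exact_mod_cast (sub_neg.mpr (D.attr_lt_rep p)).ne
  have hpos : 0 < D.mult p := D.mu_pos _ p.2
  have h2 : ((√(D.mult p) : ℝ) : ℂ) ≠ 0 := by exact_mod_cast (Real.sqrt_pos.mpr hpos).ne'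
  have hden : (toGLC (D.genSL p)) 1 0 * (D.attr p : ℂ) + (toGLC (D.genSL p)) 1 1 =
      1 / ((√(D.mult p) : ℝ) : ℂ) := by
    simp only [toGLC_apply, genSL_entry, genMatrix]
    simp
    field_simp
    ring
  change toGLC (D.genSL p) • ((D.attr p : ℂ) : OnePoint ℂ) = ((D.attr p : ℂ) : OnePoint ℂ)
  rw [OnePoint.smul_some_eq_ite, hden, if_neg (one_div_ne_zero h2), OnePoint.coe_eq_coe]
  simp only [toGLC_apply, genSL_entry, genMatrix]
  simp
  field_simp
  ring

lemma gen_repPt (p : P₁ A) : moebius (D.gen p) (D.repPt p) = D.repPt p := by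
  have h1 : (D.attr p : ℂ) - D.rep p ≠ 0 := by
    exact_mod_cast (sub_neg.mpr (D.attr_lt_rep p)).ne
  have hpos : 0 < D.mult p := D.mu_pos _ p.2
  have h2 : ((√(D.mult p) : ℝ) : ℂ) ≠ 0 := by exact_mod_cast (Real.sqrt_pos.mpr hpos).ne'
  have h3 : ((√(D.mult p) : ℝ) : ℂ) ^ 2 = D.mult p := by
    exact_mod_cast Real.sq_sqrt hpos.le
  have hden : (toGLC (D.genSL p)) 1 0 * (D.rep p : ℂ) + (toGLC (D.genSL p)) 1 1 =
      ((√(D.mult p) : ℝ) : ℂ) := by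
    simp only [toGLC_apply, genSL_entry, genMatrix]
    simp
    field_simp
    rw [h3]
    ring
  change toGLC (D.genSL p) • ((D.rep p : ℂ) : OnePoint ℂ) = ((D.rep p : ℂ) : OnePoint ℂ)
  rw [OnePoint.smul_some_eq_ite, hden, if_neg h2, OnePoint.coe_eq_coe]
  simp only [toGLC_apply, genSL_entry, genMatrix]
  simp
  field_simp
  rw [h3]
  ring

/-- A point fixed by `γ_{[i,j]}` has the same image under all elements of a coset. -/
lemma orbit_eq (p : P₁ A) (x : OnePoint ℂ) (hx : moebius (D.gen p) x = x) (a b : D.Gam)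
    (h : QuotientGroup.leftRel (D.cyc p) a b) : moebius a x = moebius b x := by
  obtain ⟨n, hn⟩ := Subgroup.mem_zpowers_iff.mp (QuotientGroup.leftRel_apply.mp h)
  have hb : (b : PSL2R) = a * D.gen p ^ n := by
    have : b = a * D.genG p ^ n := by rw [hn]; group
    rw [this]
    rfl
  rw [hb, map_mul, map_zpow, Equiv.Perm.mul_apply, Equiv.Perm.zpow_apply_eq_self_of_apply_eq_self hx]

/-- The term `1 / (z - γ(κ_{k,l})) - 1 / (z - γ(κ_{l,k}))` of the Poincaré series, as a function of
the coset of `γ` in `Γ_A / ⟨γ_{[k,l]}⟩`. -/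
def seriesTerm (q : P₁ A) (c : D.Gam ⧸ D.cyc q) (z : ℂ) : ℂ :=
  Quotient.liftOn' c
    (fun γ => poleTerm (moebius γ (D.attrPt q)) z - poleTerm (moebius γ (D.repPt q)) z)
    fun a b h => by
      simp only [D.orbit_eq q _ (D.gen_attrPt q) a b h, D.orbit_eq q _ (D.gen_repPt q) a b h]

/-- The coefficient of `dz` in the differential `ω_{[k,l]}`. -/
def omega (q : P₁ A) (z : ℂ) : ℂ :=
  1 / (2 * π * I) * ∑' c : D.Gam ⧸ D.cyc q, D.seriesTerm q c z

open Classical in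
/-- The quantity whose logarithm enters the period formula: the cross ratio
`[κ_{i,j}, κ_{j,i}; γ(κ_{k,l}), γ(κ_{l,k})]`, which is understood to be `μ_{i,j}` when
`[i,j] = [k,l]` and `γ ∈ ⟨γ_{[i,j]}⟩`. -/
def periodRatio (p q : P₁ A) (γ : D.Gam) : ℂ :=
  if p = q ∧ γ ∈ D.cyc p then (D.mult p : ℂ)
  else crossRatio (D.attrPt p) (D.repPt p) (moebius γ (D.attrPt q)) (moebius γ (D.repPt q))

/-- The double cosets `⟨γ_{[i,j]}⟩ \ Γ_A / ⟨γ_{[k,l]}⟩`. -/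
abbrev DCoset (p q : P₁ A) : Type :=
  DoubleCoset.Quotient (D.cyc p : Set D.Gam) (D.cyc q : Set D.Gam)

/-- `β` is a path in the plane from a point `a` to `γ_{[i,j]}(a)`. -/
structure JoinsByGen (p : P₁ A) (β : ℝ → ℂ) : Prop where
  path : IsIntegrationPath β
  endpoint : moebius (D.gen p) (β 0 : OnePoint ℂ) = (β 1 : OnePoint ℂ)

/-- `β` represents the cycle `b_{[i,j]}` on `Ω(Γ_A) / Γ_A`: it is a path in `Ω(Γ_A)` from a point
`a` to `γ_{[i,j]}(a)`. -/
structure IsBCycle (p : P₁ A) (β : ℝ → ℂ) : Prop extends D.JoinsByGen p β where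
  mem_disc : ∀ t ∈ Icc (0 : ℝ) 1, (β t : OnePoint ℂ) ∈ discontinuitySet D.Gam

end Params
end KPSchottky
end

/-! Everything rests on ping-pong. A letter `γ_p^{±1}` sends the exterior of its isometric disc into
the open disc of the inverse letter. Since the discs are disjoint, a reduced word sends any point
outside the disc of its last letter into the disc opposite to its first letter (`word_mem_isoBall`).
Cosets of `⟨γ_q⟩` are represented by reduced words not ending in `γ_q^{±1}`, and such words may be
applied to both fixed points of `γ_q`.

Convergence comes from lengths on the real line. A segment outside all discs has pairwise disjoint
translates in a bounded interval, so the lengths of the translates are summable. The pole of a word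
lies in the disc of its last letter, away from the fixed points of `γ_q`, so `|γ(κ_{k,l}) -
γ(κ_{l,k})|` is bounded by a constant times the length of the translate (`exists_interval`,
`summable_abs_sub`). Points of `Ω` keep a positive distance from the orbits of fixed points, which
gives normal convergence and term-by-term integration.

For the `a`-periods, the two poles of a term outside the identity coset lie in the same isometric
disc, so their residues cancel; the identity coset gives the answer (`circleIntegral_omega`).

For the `b`-periods, the cosets are grouped into double cosets. A fibre is normally an orbit `γ_p^n
γ`, `n ∈ ℤ`. In the coordinate `cay` the map `γ_p` is multiplication by `μ`, so the contribution of
the end of the path for `n` matches that of its beginning for `n - 1` (`ratio_orbit`). The sum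
telescopes, and its exponential is the limit of the ratio at `-∞` divided by that at `+∞`, which is
the cross ratio (`telescope_exp`). This gives the period modulo `ℤ`.

In the upper half-plane the same is done with principal logarithms (`telescope_log`). Along the
orbit the ratios stay in one half-plane; a `2πi` appears only when they approach a negative limit
from below. That requires the fixed points of `γ_p` to separate the two points, and outside the
identity double coset those points lie, up to a power of `γ_p`, in one disc containing neither fixed
point (`isRegular_and_crossing`). Hence there is at most one correction, and the logarithms are
summable as well. -/

noncomputable section

namespace KPSchottky

variable {N M : ℕ}

/-! ### Möbius transformations in coordinates and isometric circles -/

open Matrix.SpecialLinearGroup in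
lemma inv_entries (g : Matrix.SpecialLinearGroup (Fin 2) ℝ) :
    g⁻¹ 0 0 = g 1 1 ∧ g⁻¹ 0 1 = - g 0 1 ∧ g⁻¹ 1 0 = - g 1 0 ∧ g⁻¹ 1 1 = g 0 0 := by
  rw [SL2_inv_expl]
  exact ⟨rfl, rfl, rfl, rfl⟩

lemma det_entries (g : Matrix.SpecialLinearGroup (Fin 2) ℝ) :
    g 0 0 * g 1 1 - g 0 1 * g 1 0 = 1 := by
  have := g.det_coe
  rwa [Matrix.det_fin_two] at this

lemma moebius_coe_of_ne (g : Matrix.SpecialLinearGroup (Fin 2) ℝ) (z : ℂ)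
    (h : (g 1 0 : ℂ) * z + (g 1 1 : ℂ) ≠ 0) :
    moebius (QuotientGroup.mk g) (z : OnePoint ℂ) =
      ((((g 0 0 : ℂ) * z + (g 0 1 : ℂ)) / ((g 1 0 : ℂ) * z + (g 1 1 : ℂ)) : ℂ) : OnePoint ℂ) := by
  exact (OnePoint.smul_some_eq_ite (g := toGLC g) (k := z)).trans (if_neg h)

lemma moebius_coe_of_eq (g : Matrix.SpecialLinearGroup (Fin 2) ℝ) (z : ℂ)
    (h : (g 1 0 : ℂ) * z + (g 1 1 : ℂ) = 0) :
    moebius (QuotientGroup.mk g) (z : OnePoint ℂ) = OnePoint.infty := by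
  exact (OnePoint.smul_some_eq_ite (g := toGLC g) (k := z)).trans (if_pos h)

lemma moebius_coe_eq_coe (g : Matrix.SpecialLinearGroup (Fin 2) ℝ) {z w : ℂ}
    (h : moebius (QuotientGroup.mk g) (z : OnePoint ℂ) = w) :
    (g 1 0 : ℂ) * z + (g 1 1 : ℂ) ≠ 0 ∧
      w * ((g 1 0 : ℂ) * z + (g 1 1 : ℂ)) = (g 0 0 : ℂ) * z + (g 0 1 : ℂ) := by
  have h0 : (g 1 0 : ℂ) * z + (g 1 1 : ℂ) ≠ 0 := by
    intro h0
    rw [moebius_coe_of_eq g z h0] at h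
    exact OnePoint.infty_ne_coe _ h
  rw [moebius_coe_of_ne g z h0, OnePoint.coe_eq_coe] at h
  exact ⟨h0, by rw [← h, div_mul_cancel₀ _ h0]⟩

lemma moebius_infty_of_ne (g : Matrix.SpecialLinearGroup (Fin 2) ℝ) (h : g 1 0 ≠ 0) :
    moebius (QuotientGroup.mk g) OnePoint.infty = (((g 0 0 : ℂ) / (g 1 0 : ℂ) : ℂ) : OnePoint ℂ) := by
  exact (OnePoint.smul_infty_eq_ite (toGLC g)).trans (if_neg (Complex.ofReal_ne_zero.mpr h))

lemma moebius_infty_of_eq (g : Matrix.SpecialLinearGroup (Fin 2) ℝ) (h : g 1 0 = 0) :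
    moebius (QuotientGroup.mk g) OnePoint.infty = OnePoint.infty := by
  exact (OnePoint.smul_infty_eq_ite (toGLC g)).trans (if_pos (Complex.ofReal_eq_zero.mpr h))

/-- The difference of two values of a Möbius transformation. -/
lemma moebius_sub (g : Matrix.SpecialLinearGroup (Fin 2) ℝ) {z w z' w' : ℂ}
    (hz : moebius (QuotientGroup.mk g) (z : OnePoint ℂ) = z')
    (hw : moebius (QuotientGroup.mk g) (w : OnePoint ℂ) = w') :
    (z' - w') * (((g 1 0 : ℂ) * z + (g 1 1 : ℂ)) * ((g 1 0 : ℂ) * w + (g 1 1 : ℂ))) = z - w := by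
  obtain ⟨-, h1⟩ := moebius_coe_eq_coe g hz
  obtain ⟨-, h2⟩ := moebius_coe_eq_coe g hw
  have hd : (g 0 0 : ℂ) * g 1 1 - g 0 1 * g 1 0 = 1 := by exact_mod_cast det_entries g
  linear_combination h1 * ((g 1 0 : ℂ) * w + g 1 1) - h2 * ((g 1 0 : ℂ) * z + g 1 1) + (z - w) * hd

lemma moebius_real (γ : PSL2R) (x : ℝ) {w : ℂ}
    (h : moebius γ ((x : ℂ) : OnePoint ℂ) = w) : ∃ y : ℝ, w = y := by
  obtain ⟨g, rfl⟩ := QuotientGroup.mk_surjective γ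
  obtain ⟨h0, -⟩ := moebius_coe_eq_coe g h
  rw [moebius_coe_of_ne g _ h0, OnePoint.coe_eq_coe] at h
  exact ⟨(g 0 0 * x + g 0 1) / (g 1 0 * x + g 1 1), by rw [← h]; push_cast; rfl⟩

lemma moebius_upper (γ : PSL2R) (z : ℂ) (hz : 0 < z.im) :
    ∃ w : ℂ, 0 < w.im ∧ moebius γ (z : OnePoint ℂ) = w := by
  obtain ⟨g, rfl⟩ := QuotientGroup.mk_surjective γ
  have hd := det_entries g
  have h0 : (g 1 0 : ℂ) * z + (g 1 1 : ℂ) ≠ 0 := by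
    intro h
    have him := congrArg Complex.im h
    have hre := congrArg Complex.re h
    simp at him hre
    rcases him with h1 | h1
    · rw [h1] at hre hd
      simp at hre
      rw [hre] at hd
      simp at hd
    · exact hz.ne' h1
  refine ⟨_, ?_, moebius_coe_of_ne g z h0⟩
  have hn : 0 < Complex.normSq ((g 1 0 : ℂ) * z + (g 1 1 : ℂ)) := Complex.normSq_pos.mpr h0
  rw [Complex.div_im, ← sub_div]
  refine div_pos ?_ hn
  simp
  nlinarith

lemma isoCenter_inv (g : Matrix.SpecialLinearGroup (Fin 2) ℝ) :
    isoCenter g⁻¹ = (g 0 0 : ℂ) / (g 1 0 : ℂ) := by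
  obtain ⟨-, -, h3, h4⟩ := inv_entries g
  rw [isoCenter, h3, h4]
  push_cast
  rw [neg_div_neg_eq]

lemma isoRadius_inv (g : Matrix.SpecialLinearGroup (Fin 2) ℝ) : isoRadius g⁻¹ = isoRadius g := by
  obtain ⟨-, -, h3, h4⟩ := inv_entries g
  rw [isoRadius, isoRadius, h3, abs_neg]

lemma dist_isoCenter_mul (g : Matrix.SpecialLinearGroup (Fin 2) ℝ) (hc : g 1 0 ≠ 0) (z : ℂ) :
    dist z (isoCenter g) = ‖(g 1 0 : ℂ) * z + (g 1 1 : ℂ)‖ * isoRadius g := by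
  have hcc : ((g 1 0 : ℝ) : ℂ) ≠ 0 := by exact_mod_cast hc
  have h : z - isoCenter g = ((g 1 0 : ℂ) * z + (g 1 1 : ℂ)) / (g 1 0 : ℂ) := by
    unfold isoCenter
    push_cast
    field_simp
    ring
  rw [dist_eq_norm, h, norm_div, Complex.norm_real, Real.norm_eq_abs, isoRadius, div_eq_mul_inv]

lemma isoRadius_pos (g : Matrix.SpecialLinearGroup (Fin 2) ℝ) (hc : g 1 0 ≠ 0) :
    0 < isoRadius g := inv_pos.mpr (abs_pos.mpr hc)

/-- This rests on `g z - a/c = -1 / (c (c z + d))`: distances to the centres of the two isometric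
circles are inversely proportional. -/
lemma dist_moebius_isoCenter_inv (g : Matrix.SpecialLinearGroup (Fin 2) ℝ) (hc : g 1 0 ≠ 0) (z : ℂ)
    (h : (g 1 0 : ℂ) * z + (g 1 1 : ℂ) ≠ 0) :
    dist (((g 0 0 : ℂ) * z + (g 0 1 : ℂ)) / ((g 1 0 : ℂ) * z + (g 1 1 : ℂ))) (isoCenter g⁻¹) =
      isoRadius g / ‖(g 1 0 : ℂ) * z + (g 1 1 : ℂ)‖ := by
  have hcc : ((g 1 0 : ℝ) : ℂ) ≠ 0 := by exact_mod_cast hc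
  have hd : (g 0 0 : ℂ) * g 1 1 - g 0 1 * g 1 0 = 1 := by exact_mod_cast det_entries g
  have : ((g 0 0 : ℂ) * z + (g 0 1 : ℂ)) / ((g 1 0 : ℂ) * z + (g 1 1 : ℂ)) - (g 0 0 : ℂ) / (g 1 0 : ℂ) =
      -1 / (g 1 0 * ((g 1 0 : ℂ) * z + (g 1 1 : ℂ))) := by
    rw [div_sub_div _ _ h hcc, div_eq_div_iff (mul_ne_zero h hcc) (mul_ne_zero hcc h)]
    linear_combination (-(((g 1 0 : ℂ) * z + (g 1 1 : ℂ)) * g 1 0)) * hd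
  rw [isoCenter_inv, dist_eq_norm, this, norm_div, norm_mul, norm_neg, norm_one, Complex.norm_real,
    Real.norm_eq_abs, isoRadius, one_div, mul_inv, div_eq_mul_inv]

/-- The exterior of the isometric circle of `g` is mapped into the disc bounded by the isometric
circle of `g⁻¹`. -/
lemma moebius_mem_ball (g : Matrix.SpecialLinearGroup (Fin 2) ℝ) (hc : g 1 0 ≠ 0)
    (x : OnePoint ℂ)
    (hx : x ∉ ((↑) : ℂ → OnePoint ℂ) '' Metric.closedBall (isoCenter g) (isoRadius g)) :
    moebius (QuotientGroup.mk g) x ∈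
      ((↑) : ℂ → OnePoint ℂ) '' Metric.ball (isoCenter g⁻¹) (isoRadius g⁻¹) := by
  have hr := isoRadius_pos g hc
  cases x with
  | infty =>
    refine ⟨_, ?_, (moebius_infty_of_ne g hc).symm⟩
    rw [← isoCenter_inv, isoRadius_inv]
    exact Metric.mem_ball_self hr
  | coe z =>
    have hz : z ∉ Metric.closedBall (isoCenter g) (isoRadius g) := fun h => hx ⟨z, h, rfl⟩
    rw [Metric.mem_closedBall, dist_isoCenter_mul g hc, not_le] at hz
    have h1 : 1 < ‖(g 1 0 : ℂ) * z + (g 1 1 : ℂ)‖ := by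
      by_contra! h
      nlinarith
    have h0 : (g 1 0 : ℂ) * z + (g 1 1 : ℂ) ≠ 0 := by
      intro h
      rw [h, norm_zero] at h1
      linarith
    refine ⟨_, ?_, (moebius_coe_of_ne g z h0).symm⟩
    rw [Metric.mem_ball, dist_moebius_isoCenter_inv g hc z h0, isoRadius_inv]
    exact div_lt_self hr h1

namespace Params

variable {A : Matrix (Fin N) (Fin M) ℝ} (D : Params A)

/-! ### Reduced words and the ping-pong dynamics -/

/-- The matrix of the letter `γ_p` (label `true`) or `γ_p⁻¹` (label `false`). -/
def letterSL (s : P₁ A × Bool) : Matrix.SpecialLinearGroup (Fin 2) ℝ :=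
  cond s.2 (D.genSL s.1) (D.genSL s.1)⁻¹

/-- The element of `Γ_A` given by a letter. -/
def letter (s : P₁ A × Bool) : D.Gam := cond s.2 (D.genG s.1) (D.genG s.1)⁻¹

/-- The inverse letter. -/
def opp (s : P₁ A × Bool) : P₁ A × Bool := (s.1, !s.2)

/-- The open disc bounded by the isometric circle of a letter. -/
def isoBall (s : P₁ A × Bool) : Set ℂ :=
  Metric.ball (isoCenter (D.letterSL s)) (isoRadius (D.letterSL s))

/-- The element of `Γ_A` given by a word. -/
def word (L : List (P₁ A × Bool)) : D.Gam := (L.map D.letter).prod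

lemma word_nil : D.word [] = 1 := rfl

lemma word_cons (s : P₁ A × Bool) (L : List (P₁ A × Bool)) :
    D.word (s :: L) = D.letter s * D.word L := by simp [word]

lemma word_append (L L' : List (P₁ A × Bool)) : D.word (L ++ L') = D.word L * D.word L' := by
  simp [word]

lemma letter_coe (s : P₁ A × Bool) :
    (D.letter s : PSL2R) = QuotientGroup.mk (D.letterSL s) := by
  obtain ⟨p, _ | _⟩ := s <;> rfl

lemma letterSL_opp (s : P₁ A × Bool) : D.letterSL (opp s) = (D.letterSL s)⁻¹ := by
  obtain ⟨p, _ | _⟩ := s <;> simp [letterSL, opp]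

lemma letter_opp (s : P₁ A × Bool) : D.letter (opp s) = (D.letter s)⁻¹ := by
  obtain ⟨p, _ | _⟩ := s <;> simp [letter, opp]

lemma isoDisc_eq (s : P₁ A × Bool) : D.isoDisc s =
    Metric.closedBall (isoCenter (D.letterSL s)) (isoRadius (D.letterSL s)) := by
  obtain ⟨p, _ | _⟩ := s <;> rfl

lemma isoBall_subset (s : P₁ A × Bool) : D.isoBall s ⊆ D.isoDisc s := by
  rw [isoDisc_eq]
  exact Metric.ball_subset_closedBall

lemma mult_pos (p : P₁ A) : 0 < D.mult p := D.mu_pos _ p.2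

lemma mult_lt_one (p : P₁ A) : D.mult p < 1 := D.mu_lt_one _ p.2

lemma genSL_lower_left (p : P₁ A) :
    (D.genSL p) 1 0 = (1 - D.mult p) / ((D.attr p - D.rep p) * √(D.mult p)) := by
  rw [genSL_entry, genMatrix]
  simp
  field_simp

lemma genSL_lower_right (p : P₁ A) : (D.genSL p) 1 1 =
    -(D.rep p - D.mult p * D.attr p) / ((D.attr p - D.rep p) * √(D.mult p)) := by
  rw [genSL_entry, genMatrix]
  simp
  field_simp

lemma genSL_upper_left (p : P₁ A) : (D.genSL p) 0 0 =
    (D.attr p - D.mult p * D.rep p) / ((D.attr p - D.rep p) * √(D.mult p)) := by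
  rw [genSL_entry, genMatrix]
  simp
  field_simp

lemma genSL_ne_zero (p : P₁ A) : (D.genSL p) 1 0 ≠ 0 := by
  rw [genSL_lower_left]
  have h1 : D.attr p - D.rep p ≠ 0 := (sub_neg.mpr (D.attr_lt_rep p)).ne
  have h2 : √(D.mult p) ≠ 0 := (Real.sqrt_pos.mpr (D.mult_pos p)).ne'
  have h3 : 1 - D.mult p ≠ 0 := (sub_pos.mpr (D.mult_lt_one p)).ne'
  positivity

lemma letterSL_ne_zero (s : P₁ A × Bool) : (D.letterSL s) 1 0 ≠ 0 := by
  obtain ⟨p, _ | _⟩ := s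
  · change (D.genSL p)⁻¹ 1 0 ≠ 0
    rw [(inv_entries _).2.2.1]
    exact neg_ne_zero.mpr (D.genSL_ne_zero p)
  · exact D.genSL_ne_zero p

lemma sqrt_mult_lt_one (p : P₁ A) : √(D.mult p) < 1 := by
  rw [Real.sqrt_lt' one_pos]
  simpa using D.mult_lt_one p

/-- At the repulsive fixed point `c z + d` equals `√μ < 1`, so the point is strictly inside the
isometric circle. -/
lemma rep_mem_isoBall (p : P₁ A) : (D.rep p : ℂ) ∈ D.isoBall (p, true) := by
  have h1 : D.attr p - D.rep p ≠ 0 := (sub_neg.mpr (D.attr_lt_rep p)).ne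
  have h2 : 0 < √(D.mult p) := Real.sqrt_pos.mpr (D.mult_pos p)
  have h3 : √(D.mult p) ^ 2 = D.mult p := Real.sq_sqrt (D.mult_pos p).le
  change (D.rep p : ℂ) ∈ Metric.ball (isoCenter (D.genSL p)) (isoRadius (D.genSL p))
  rw [Metric.mem_ball, dist_isoCenter_mul _ (D.genSL_ne_zero p)]
  refine mul_lt_of_lt_one_left (isoRadius_pos _ (D.genSL_ne_zero p)) ?_
  have : (D.genSL p) 1 0 * D.rep p + (D.genSL p) 1 1 = √(D.mult p) := by
    rw [genSL_lower_left, genSL_lower_right]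
    field_simp
    rw [h3]
    ring
  rw [← Complex.ofReal_mul, ← Complex.ofReal_add, this, Complex.norm_real, Real.norm_eq_abs,
    abs_of_pos h2]
  exact D.sqrt_mult_lt_one p

lemma attr_mem_isoBall (p : P₁ A) : (D.attr p : ℂ) ∈ D.isoBall (p, false) := by
  have h1 : D.attr p - D.rep p ≠ 0 := (sub_neg.mpr (D.attr_lt_rep p)).ne
  have h2 : 0 < √(D.mult p) := Real.sqrt_pos.mpr (D.mult_pos p)
  have h3 : √(D.mult p) ^ 2 = D.mult p := Real.sq_sqrt (D.mult_pos p).le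
  change (D.attr p : ℂ) ∈ Metric.ball (isoCenter (D.genSL p)⁻¹) (isoRadius (D.genSL p)⁻¹)
  have hc := D.letterSL_ne_zero (p, false)
  change (D.genSL p)⁻¹ 1 0 ≠ 0 at hc
  rw [Metric.mem_ball, dist_isoCenter_mul _ hc]
  refine mul_lt_of_lt_one_left (isoRadius_pos _ hc) ?_
  have : (D.genSL p)⁻¹ 1 0 * D.attr p + (D.genSL p)⁻¹ 1 1 = √(D.mult p) := by
    rw [(inv_entries _).2.2.1, (inv_entries _).2.2.2, genSL_lower_left, genSL_upper_left]
    field_simp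
    rw [h3]
    ring
  rw [← Complex.ofReal_mul, ← Complex.ofReal_add, this, Complex.norm_real, Real.norm_eq_abs,
    abs_of_pos h2]
  exact D.sqrt_mult_lt_one p

lemma letter_mem_isoBall (s : P₁ A × Bool) {x : OnePoint ℂ}
    (hx : x ∉ ((↑) : ℂ → OnePoint ℂ) '' D.isoDisc s) :
    moebius (D.letter s) x ∈ ((↑) : ℂ → OnePoint ℂ) '' D.isoBall (opp s) := by
  rw [isoDisc_eq] at hx
  rw [isoBall, letterSL_opp, letter_coe]
  exact moebius_mem_ball _ (D.letterSL_ne_zero s) x hx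

lemma infty_notMem_image (U : Set ℂ) : OnePoint.infty ∉ ((↑) : ℂ → OnePoint ℂ) '' U := by
  rintro ⟨z, -, hz⟩
  exact OnePoint.coe_ne_infty z hz

lemma coe_mem_image_iff {z : ℂ} {U : Set ℂ} :
    (z : OnePoint ℂ) ∈ ((↑) : ℂ → OnePoint ℂ) '' U ↔ z ∈ U := by
  simp

variable {D} in
lemma notMem_image_isoDisc (hD : D.DisjointIsometricCircles) {s t : P₁ A × Bool} (hst : s ≠ t)
    {x : OnePoint ℂ} (hx : x ∈ ((↑) : ℂ → OnePoint ℂ) '' D.isoDisc s) :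
    x ∉ ((↑) : ℂ → OnePoint ℂ) '' D.isoDisc t := by
  obtain ⟨z, hz, rfl⟩ := hx
  rw [coe_mem_image_iff]
  exact fun h => Set.disjoint_left.mp (hD hst) hz h

variable {D} in
/-- A reduced word maps the exterior of the isometric disc of its last letter into the open
isometric disc of the inverse of its first letter. -/
lemma word_mem_isoBall (hD : D.DisjointIsometricCircles) (L : List (P₁ A × Bool))
    (hL : FreeGroup.IsReduced L) {x : OnePoint ℂ}
    (hx : ∀ s ∈ L.getLast?, x ∉ ((↑) : ℂ → OnePoint ℂ) '' D.isoDisc s) :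
    ∀ t ∈ L.head?, moebius (D.word L) x ∈ ((↑) : ℂ → OnePoint ℂ) '' D.isoBall (opp t) := by
  induction L with
  | nil => simp
  | cons s L ih =>
    intro t ht
    obtain rfl : s = t := by simpa using ht
    rw [word_cons, Subgroup.coe_mul, map_mul, Equiv.Perm.mul_apply]
    apply letter_mem_isoBall
    cases L with
    | nil => simpa [word_nil] using hx
    | cons u L =>
      rw [FreeGroup.isReduced_cons_cons] at hL
      have h := ih hL.2 (fun v hv => hx v (by simpa using hv)) u (by simp)
      refine notMem_image_isoDisc hD ?_ (Set.image_mono (D.isoBall_subset _) h)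
      rintro rfl
      have := hL.1 rfl
      simp [opp] at this

lemma exists_word (γ : D.Gam) : ∃ L, FreeGroup.IsReduced L ∧ D.word L = γ := by
  obtain ⟨γ, hγ⟩ := γ
  have h : γ ∈ (FreeGroup.lift D.gen).range := by
    rw [FreeGroup.range_lift_eq_closure]
    exact hγ
  obtain ⟨w, rfl⟩ := h
  refine ⟨w.toWord, FreeGroup.isReduced_toWord, Subtype.ext ?_⟩
  change _ = FreeGroup.lift D.gen w
  conv_rhs => rw [← FreeGroup.mk_toWord (x := w)]
  rw [FreeGroup.lift_mk, word, Subgroup.val_list_prod, List.map_map]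
  congr 2
  funext s
  obtain ⟨p, _ | _⟩ := s <;> rfl

lemma letter_eq_zpow (s : P₁ A × Bool) : ∃ k : ℤ, D.letter s = D.genG s.1 ^ k := by
  obtain ⟨p, _ | _⟩ := s
  · exact ⟨-1, by simp [letter]⟩
  · exact ⟨1, by simp [letter]⟩

/-- Trailing letters `γ_q^{±1}` are absorbed into a power of `γ_q`; what remains can be applied to
the fixed points of `γ_q` by ping-pong. -/
lemma word_strip_right (q : P₁ A) (L : List (P₁ A × Bool)) (hL : FreeGroup.IsReduced L) :
    ∃ (L' : List (P₁ A × Bool)) (k : ℤ), FreeGroup.IsReduced L' ∧ (∀ s ∈ L'.getLast?, s.1 ≠ q) ∧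
      D.word L = D.word L' * D.genG q ^ k := by
  induction L using List.reverseRecOn with
  | nil => exact ⟨[], 0, hL, by simp, by simp⟩
  | append_singleton L s ih =>
    by_cases hs : s.1 = q
    · obtain ⟨L', k, h1, h2, h3⟩ := ih (hL.infix ⟨[], [s], by simp⟩)
      obtain ⟨j, hj⟩ := D.letter_eq_zpow s
      refine ⟨L', k + j, h1, h2, ?_⟩
      rw [word_append, h3, word_cons, hj, hs, word_nil, mul_one, zpow_add, mul_assoc]
    · exact ⟨L ++ [s], 0, hL, by simpa using hs, by simp⟩

lemma word_strip_left (p q : P₁ A) (L : List (P₁ A × Bool)) (hL : FreeGroup.IsReduced L)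
    (hq : ∀ s ∈ L.getLast?, s.1 ≠ q) :
    ∃ (L' : List (P₁ A × Bool)) (k : ℤ), FreeGroup.IsReduced L' ∧ (∀ s ∈ L'.getLast?, s.1 ≠ q) ∧
      (∀ s ∈ L'.head?, s.1 ≠ p) ∧ D.word L = D.genG p ^ k * D.word L' := by
  induction L with
  | nil => exact ⟨[], 0, hL, by simp, by simp, by simp⟩
  | cons s L ih =>
    by_cases hs : s.1 = p
    · obtain ⟨L', k, h1, h2, h3, h4⟩ := ih (hL.infix ⟨[s], [], by simp⟩) (fun v hv => hq v (by
        cases L with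
        | nil => simp at hv
        | cons u L => simpa using hv))
      obtain ⟨j, hj⟩ := D.letter_eq_zpow s
      refine ⟨L', j + k, h1, h2, h3, ?_⟩
      rw [word_cons, h4, hj, hs, zpow_add, mul_assoc]
    · exact ⟨s :: L, 0, hL, hq, by simpa using hs, by simp⟩

lemma exists_word_coset (q : P₁ A) (γ : D.Gam) :
    ∃ (L : List (P₁ A × Bool)) (k : ℤ), FreeGroup.IsReduced L ∧ (∀ s ∈ L.getLast?, s.1 ≠ q) ∧
      γ = D.word L * D.genG q ^ k := by
  obtain ⟨L, hL, rfl⟩ := D.exists_word γ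
  exact D.word_strip_right q L hL

lemma exists_word_doubleCoset (p q : P₁ A) (γ : D.Gam) :
    ∃ (L : List (P₁ A × Bool)) (m k : ℤ), FreeGroup.IsReduced L ∧ (∀ s ∈ L.getLast?, s.1 ≠ q) ∧
      (∀ s ∈ L.head?, s.1 ≠ p) ∧ γ = D.genG p ^ m * D.word L * D.genG q ^ k := by
  obtain ⟨L, k, h1, h2, rfl⟩ := D.exists_word_coset q γ
  obtain ⟨L', m, h3, h4, h5, h6⟩ := D.word_strip_left p q L h1 h2
  exact ⟨L', m, k, h3, h4, h5, by rw [h6]⟩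

/-! ### Images of the fixed points -/

lemma gen_zpow_attrPt (q : P₁ A) (k : ℤ) :
    moebius ((D.genG q ^ k : D.Gam) : PSL2R) (D.attrPt q) = D.attrPt q := by
  rw [Subgroup.coe_zpow, map_zpow]
  exact Equiv.Perm.zpow_apply_eq_self_of_apply_eq_self (D.gen_attrPt q) k

lemma gen_zpow_repPt (q : P₁ A) (k : ℤ) :
    moebius ((D.genG q ^ k : D.Gam) : PSL2R) (D.repPt q) = D.repPt q := by
  rw [Subgroup.coe_zpow, map_zpow]
  exact Equiv.Perm.zpow_apply_eq_self_of_apply_eq_self (D.gen_repPt q) k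

lemma moebius_mul_gen_zpow_attrPt (q : P₁ A) (γ : D.Gam) (k : ℤ) :
    moebius ((γ * D.genG q ^ k : D.Gam) : PSL2R) (D.attrPt q) = moebius γ (D.attrPt q) := by
  rw [Subgroup.coe_mul, map_mul, Equiv.Perm.mul_apply, gen_zpow_attrPt]

lemma moebius_mul_gen_zpow_repPt (q : P₁ A) (γ : D.Gam) (k : ℤ) :
    moebius ((γ * D.genG q ^ k : D.Gam) : PSL2R) (D.repPt q) = moebius γ (D.repPt q) := by
  rw [Subgroup.coe_mul, map_mul, Equiv.Perm.mul_apply, gen_zpow_repPt]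

variable {D}

lemma attrPt_notMem (hD : D.DisjointIsometricCircles) {q : P₁ A} {s : P₁ A × Bool} (hs : s.1 ≠ q) :
    D.attrPt q ∉ ((↑) : ℂ → OnePoint ℂ) '' D.isoDisc s := by
  refine notMem_image_isoDisc hD (s := (q, false)) ?_ ⟨_, D.isoBall_subset _ (D.attr_mem_isoBall q), rfl⟩
  rintro rfl
  exact hs rfl

lemma repPt_notMem (hD : D.DisjointIsometricCircles) {q : P₁ A} {s : P₁ A × Bool} (hs : s.1 ≠ q) :
    D.repPt q ∉ ((↑) : ℂ → OnePoint ℂ) '' D.isoDisc s := by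
  refine notMem_image_isoDisc hD (s := (q, true)) ?_ ⟨_, D.isoBall_subset _ (D.rep_mem_isoBall q), rfl⟩
  rintro rfl
  exact hs rfl

lemma word_attrPt_mem (hD : D.DisjointIsometricCircles) {q : P₁ A} {L : List (P₁ A × Bool)}
    (hL : FreeGroup.IsReduced L) (hq : ∀ s ∈ L.getLast?, s.1 ≠ q) :
    ∀ t ∈ L.head?, moebius (D.word L) (D.attrPt q) ∈ ((↑) : ℂ → OnePoint ℂ) '' D.isoBall (opp t) :=
  word_mem_isoBall hD L hL fun s hs => attrPt_notMem hD (hq s hs)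

lemma word_repPt_mem (hD : D.DisjointIsometricCircles) {q : P₁ A} {L : List (P₁ A × Bool)}
    (hL : FreeGroup.IsReduced L) (hq : ∀ s ∈ L.getLast?, s.1 ≠ q) :
    ∀ t ∈ L.head?, moebius (D.word L) (D.repPt q) ∈ ((↑) : ℂ → OnePoint ℂ) '' D.isoBall (opp t) :=
  word_mem_isoBall hD L hL fun s hs => repPt_notMem hD (hq s hs)

/-- The image is never `∞`: after stripping `γ_q` it is either the fixed point itself or a point of
an isometric disc. -/
lemma exists_real_attrPt (hD : D.DisjointIsometricCircles) (q : P₁ A) (γ : D.Gam) :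
    ∃ x : ℝ, moebius γ (D.attrPt q) = ((x : ℂ) : OnePoint ℂ) := by
  obtain ⟨L, k, h1, h2, rfl⟩ := D.exists_word_coset q γ
  rw [moebius_mul_gen_zpow_attrPt]
  cases L with
  | nil => exact ⟨D.attr q, by simp [word_nil, attrPt]⟩
  | cons s L =>
    obtain ⟨z, -, hz⟩ := word_attrPt_mem hD h1 h2 s (by simp)
    obtain ⟨x, rfl⟩ := moebius_real _ _ hz.symm
    exact ⟨x, hz.symm⟩

lemma exists_real_repPt (hD : D.DisjointIsometricCircles) (q : P₁ A) (γ : D.Gam) :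
    ∃ x : ℝ, moebius γ (D.repPt q) = ((x : ℂ) : OnePoint ℂ) := by
  obtain ⟨L, k, h1, h2, rfl⟩ := D.exists_word_coset q γ
  rw [moebius_mul_gen_zpow_repPt]
  cases L with
  | nil => exact ⟨D.rep q, by simp [word_nil, repPt]⟩
  | cons s L =>
    obtain ⟨z, -, hz⟩ := word_repPt_mem hD h1 h2 s (by simp)
    obtain ⟨x, rfl⟩ := moebius_real _ _ hz.symm
    exact ⟨x, hz.symm⟩

variable (D) in
/-- The affine coordinate of `γ(κ_{k,l})`. -/
def attrImg (q : P₁ A) (γ : D.Gam) : ℝ := (moebius γ (D.attrPt q)).elim 0 Complex.re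

variable (D) in
/-- The affine coordinate of `γ(κ_{l,k})`. -/
def repImg (q : P₁ A) (γ : D.Gam) : ℝ := (moebius γ (D.repPt q)).elim 0 Complex.re

/-- The default value `0` at `∞` and the passage to the real part in `attrImg` never come into play.
-/
lemma attrImg_spec (hD : D.DisjointIsometricCircles) (q : P₁ A) (γ : D.Gam) :
    moebius γ (D.attrPt q) = ((D.attrImg q γ : ℂ) : OnePoint ℂ) := by
  obtain ⟨x, hx⟩ := exists_real_attrPt hD q γ
  simp [attrImg, hx]

lemma repImg_spec (hD : D.DisjointIsometricCircles) (q : P₁ A) (γ : D.Gam) :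
    moebius γ (D.repPt q) = ((D.repImg q γ : ℂ) : OnePoint ℂ) := by
  obtain ⟨x, hx⟩ := exists_real_repPt hD q γ
  simp [repImg, hx]

lemma attrImg_mul_zpow (q : P₁ A) (γ : D.Gam) (k : ℤ) :
    D.attrImg q (γ * D.genG q ^ k) = D.attrImg q γ := by
  rw [attrImg, moebius_mul_gen_zpow_attrPt, attrImg]

lemma repImg_mul_zpow (q : P₁ A) (γ : D.Gam) (k : ℤ) :
    D.repImg q (γ * D.genG q ^ k) = D.repImg q γ := by
  rw [repImg, moebius_mul_gen_zpow_repPt, repImg]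

lemma attrImg_one (q : P₁ A) : D.attrImg q 1 = D.attr q := by
  simp [attrImg, attrPt]

lemma repImg_one (q : P₁ A) : D.repImg q 1 = D.rep q := by
  simp [repImg, repPt]

lemma seriesTerm_mk (hD : D.DisjointIsometricCircles) (q : P₁ A) (γ : D.Gam) (z : ℂ) :
    D.seriesTerm q (QuotientGroup.mk γ) z =
      1 / (z - D.attrImg q γ) - 1 / (z - D.repImg q γ) := by
  change poleTerm (moebius γ (D.attrPt q)) z - poleTerm (moebius γ (D.repPt q)) z = _
  rw [attrImg_spec hD, repImg_spec hD]
  rfl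

lemma exists_coset_rep (q : P₁ A) (c : D.Gam ⧸ D.cyc q) :
    ∃ L : List (P₁ A × Bool), FreeGroup.IsReduced L ∧ (∀ s ∈ L.getLast?, s.1 ≠ q) ∧
      QuotientGroup.mk (D.word L) = c := by
  obtain ⟨γ, rfl⟩ := QuotientGroup.mk_surjective c
  obtain ⟨L, k, h1, h2, h3⟩ := D.exists_word_coset q γ
  refine ⟨L, h1, h2, QuotientGroup.eq.mpr ?_⟩
  rw [h3]
  exact Subgroup.mem_zpowers_iff.mpr ⟨k, by group⟩

variable (D) in
/-- A reduced word not ending in `γ_q^{±1}` that represents a given coset of `⟨γ_q⟩`. -/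
def repWord (q : P₁ A) (c : D.Gam ⧸ D.cyc q) : List (P₁ A × Bool) := (exists_coset_rep q c).choose

lemma repWord_spec (q : P₁ A) (c : D.Gam ⧸ D.cyc q) : FreeGroup.IsReduced (D.repWord q c) ∧
    (∀ s ∈ (D.repWord q c).getLast?, s.1 ≠ q) ∧ QuotientGroup.mk (D.word (D.repWord q c)) = c :=
  (exists_coset_rep q c).choose_spec

lemma seriesTerm_eq (hD : D.DisjointIsometricCircles) (q : P₁ A) (c : D.Gam ⧸ D.cyc q) (z : ℂ) :
    D.seriesTerm q c z =
      1 / (z - D.attrImg q (D.word (D.repWord q c))) -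
        1 / (z - D.repImg q (D.word (D.repWord q c))) := by
  conv_lhs => rw [← (repWord_spec q c).2.2]
  exact seriesTerm_mk hD q _ z

end Params

/-! ### Summability of the distances between images of the fixed points -/

/-- The lengths of disjoint intervals contained in a bounded interval are summable. -/
lemma summable_length_of_disjoint {ι : Type*} (u v : ι → ℝ) (a b : ℝ) (huv : ∀ i, u i ≤ v i)
    (hdisj : Pairwise (Function.onFun Disjoint fun i => Ioo (u i) (v i)))
    (hsub : ∀ i, Ioo (u i) (v i) ⊆ Ioo a b) : Summable fun i => v i - u i := by
  refine summable_of_sum_le (c := (volume (Ioo a b)).toReal) (fun i => sub_nonneg.mpr (huv i)) ?_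
  intro F
  have h1 : ∑ i ∈ F, volume (Ioo (u i) (v i)) ≤ volume (Ioo a b) := by
    rw [← measure_biUnion_finset (fun i _ j _ hij => hdisj hij) fun i _ => measurableSet_Ioo]
    exact measure_mono (iUnion₂_subset fun i _ => hsub i)
  have h2 : ∑ i ∈ F, (v i - u i) = (∑ i ∈ F, volume (Ioo (u i) (v i))).toReal := by
    rw [ENNReal.toReal_sum (fun i _ => by simp)]
    refine Finset.sum_congr rfl fun i _ => ?_
    rw [Real.volume_Ioo, ENNReal.toReal_ofReal (sub_nonneg.mpr (huv i))]
  rw [h2]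
  exact ENNReal.toReal_mono (by simp) h1

namespace Params

variable {A : Matrix (Fin N) (Fin M) ℝ} {D : Params A}

variable (D) in
lemma exists_isoDisc_bound : ∃ R : ℝ, 0 < R ∧ ∀ s, ∀ z ∈ D.isoDisc s, ‖z‖ < R := by
  have h : Bornology.IsBounded (⋃ s, D.isoDisc s) := by
    rw [Bornology.isBounded_iUnion]
    intro s
    rw [isoDisc_eq]
    exact Metric.isBounded_closedBall
  obtain ⟨R, hR, hb⟩ := h.exists_pos_norm_lt
  exact ⟨R, hR, fun s z hz => hb z (mem_iUnion.mpr ⟨s, hz⟩)⟩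

/-- The fixed point is interior to a disc of `γ_q`, and that disc misses the others. This keeps the
poles of words not ending in `γ_q^{±1}` away from it. -/
lemma exists_dist_attr (hD : D.DisjointIsometricCircles) (q : P₁ A) :
    ∃ δ : ℝ, 0 < δ ∧ ∀ s : P₁ A × Bool, s.1 ≠ q → ∀ z ∈ D.isoDisc s, δ ≤ ‖(D.attr q : ℂ) - z‖ := by
  obtain ⟨δ, hδ, hb⟩ := Metric.mem_nhds_iff.mp (Metric.isOpen_ball.mem_nhds (D.attr_mem_isoBall q))
  refine ⟨δ, hδ, fun s hs z hz => ?_⟩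
  by_contra! h
  have h1 : z ∈ D.isoBall (q, false) := hb (by rwa [Metric.mem_ball', dist_eq_norm])
  have hne : s ≠ (q, false) := fun h => hs (by rw [h])
  exact Set.disjoint_left.mp (hD hne) hz (D.isoBall_subset _ h1)

lemma exists_dist_rep (hD : D.DisjointIsometricCircles) (q : P₁ A) :
    ∃ δ : ℝ, 0 < δ ∧ ∀ s : P₁ A × Bool, s.1 ≠ q → ∀ z ∈ D.isoDisc s, δ ≤ ‖(D.rep q : ℂ) - z‖ := by
  obtain ⟨δ, hδ, hb⟩ := Metric.mem_nhds_iff.mp (Metric.isOpen_ball.mem_nhds (D.rep_mem_isoBall q))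
  refine ⟨δ, hδ, fun s hs z hz => ?_⟩
  by_contra! h
  have h1 : z ∈ D.isoBall (q, true) := hb (by rwa [Metric.mem_ball', dist_eq_norm])
  have hne : s ≠ (q, true) := fun h => hs (by rw [h])
  exact Set.disjoint_left.mp (hD hne) hz (D.isoBall_subset _ h1)

/-- A nonempty reduced word has a pole in the isometric disc of its last letter. -/
lemma word_pole (hD : D.DisjointIsometricCircles) {L : List (P₁ A × Bool)}
    (hL : FreeGroup.IsReduced L) (hne : L ≠ []) {g : Matrix.SpecialLinearGroup (Fin 2) ℝ}
    (hg : (D.word L : PSL2R) = QuotientGroup.mk g) :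
    g 1 0 ≠ 0 ∧ ∃ s ∈ L.getLast?, isoCenter g ∈ D.isoDisc s := by
  have hc : g 1 0 ≠ 0 := by
    intro h
    have := word_mem_isoBall hD L hL (x := OnePoint.infty) (fun s _ => infty_notMem_image _)
      (L.head hne) (by simp [List.head?_eq_some_head hne])
    rw [hg, moebius_infty_of_eq g h] at this
    exact infty_notMem_image _ this
  refine ⟨hc, L.getLast hne, by simp [List.getLast?_eq_some_getLast hne], ?_⟩
  by_contra h
  have := word_mem_isoBall hD L hL (x := (isoCenter g : OnePoint ℂ)) (fun s hs => by
      rw [List.getLast?_eq_some_getLast hne, Option.mem_some_iff] at hs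
      rwa [← hs, coe_mem_image_iff])
    (L.head hne) (by simp [List.head?_eq_some_head hne])
  rw [hg, moebius_coe_of_eq] at this
  · exact infty_notMem_image _ this
  · have hcc : ((g 1 0 : ℝ) : ℂ) ≠ 0 := by exact_mod_cast hc
    rw [isoCenter]
    push_cast
    field_simp
    ring

/-- The translates of the common exterior of the isometric discs by distinct elements of `Γ_A` are
disjoint. -/
lemma eq_of_moebius_eq (hD : D.DisjointIsometricCircles) {γ γ' : D.Gam} {x y : OnePoint ℂ}
    (hx : ∀ s, x ∉ ((↑) : ℂ → OnePoint ℂ) '' D.isoDisc s)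
    (hy : ∀ s, y ∉ ((↑) : ℂ → OnePoint ℂ) '' D.isoDisc s)
    (h : moebius γ x = moebius γ' y) : γ = γ' := by
  obtain ⟨L, hL, hw⟩ := D.exists_word (γ'⁻¹ * γ)
  have hxy : moebius ((γ'⁻¹ * γ : D.Gam) : PSL2R) x = y := by
    rw [Subgroup.coe_mul, map_mul, Equiv.Perm.mul_apply, h, Subgroup.coe_inv, map_inv]
    exact Equiv.symm_apply_apply _ _
  cases L with
  | nil => exact (inv_mul_eq_one.mp hw.symm).symm
  | cons s L =>
    have := word_mem_isoBall hD _ hL (x := x) (fun s _ => hx s) s (by simp)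
    rw [hw, hxy] at this
    exact absurd (Set.image_mono (D.isoBall_subset _) this) (hy _)

/-- Both differences come from the formula `g x - g y = (x - y) / (c² (x - P)(y - P))` with pole
`P`. For `x, y` equal to `R, R + 1` the denominators are bounded above; for the fixed points of
`γ_q` they are bounded below. The factor `c²` cancels in the comparison. -/
lemma exists_interval (hD : D.DisjointIsometricCircles) (q : P₁ A) :
    ∃ R C : ℝ, (∀ s, ∀ z ∈ D.isoDisc s, ‖z‖ < R) ∧ ∀ L : List (P₁ A × Bool),
      FreeGroup.IsReduced L → (∀ s ∈ L.getLast?, s.1 ≠ q) → ∃ u v : ℝ, u ≤ v ∧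
        (∀ w ∈ Ioo u v, ∃ t ∈ Ioo R (R + 1), moebius (D.word L) ((t : ℂ) : OnePoint ℂ) = (w : ℂ)) ∧
        Ioo u v ⊆ Ioo (-R) (R + 1) ∧
        |D.attrImg q (D.word L) - D.repImg q (D.word L)| ≤ C * (v - u) := by
  obtain ⟨R, hR, hRb⟩ := D.exists_isoDisc_bound
  obtain ⟨δ₁, hδ₁, h₁⟩ := exists_dist_attr hD q
  obtain ⟨δ₂, hδ₂, h₂⟩ := exists_dist_rep hD q
  set K := |D.attr q - D.rep q| with hK
  -- The summand `K` serves the empty word, whose interval has length one; the other summand serves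
  -- nonempty words.
  refine ⟨R, K + K / (δ₁ * δ₂) * (2 * R + 1) ^ 2, hRb, fun L hL hq => ?_⟩
  have hK0 : 0 ≤ K := abs_nonneg _
  by_cases hne : L = []
  · subst hne
    refine ⟨R, R + 1, by linarith, fun w hw => ⟨w, hw, by simp [word_nil]⟩, ?_, ?_⟩
    · exact Ioo_subset_Ioo_left (by linarith)
    · rw [word_nil, attrImg_one, repImg_one, ← hK]
      have : 0 ≤ K / (δ₁ * δ₂) * (2 * R + 1) ^ 2 := by positivity
      linarith
  obtain ⟨g, hg⟩ := QuotientGroup.mk_surjective (D.word L : PSL2R)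
  obtain ⟨hc, s, hs, hP⟩ := word_pole hD hL hne hg.symm
  set P : ℝ := -(g 1 1) / g 1 0 with hPdef
  have hPc : isoCenter g = (P : ℂ) := rfl
  have hPR : |P| < R := by
    have := hRb s _ hP
    rwa [hPc, Complex.norm_real, Real.norm_eq_abs] at this
  have hlin : ∀ t : ℝ, g 1 0 * t + g 1 1 = g 1 0 * (t - P) := fun t => by
    rw [hPdef]
    field_simp
    ring
  have ht : ∀ t ∈ Icc R (R + 1), 0 < t - P ∧ t - P ≤ 2 * R + 1 := fun t ht => by
    have := abs_lt.mp hPR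
    constructor <;> linarith [ht.1, ht.2]
  have ht0 : ∀ t ∈ Icc R (R + 1), g 1 0 * t + g 1 1 ≠ 0 := fun t h => by
    rw [hlin]
    exact mul_ne_zero hc (ht t h).1.ne'
  set f : ℝ → ℝ := fun t => (g 0 0 * t + g 0 1) / (g 1 0 * t + g 1 1) with hf
  have hmf : ∀ t ∈ Icc R (R + 1),
      moebius (D.word L) ((t : ℂ) : OnePoint ℂ) = ((f t : ℂ) : OnePoint ℂ) := fun t h => by
    rw [← hg, moebius_coe_of_ne g t (by exact_mod_cast ht0 t h)]
    simp [hf]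
  have hu : R ∈ Icc R (R + 1) := ⟨le_rfl, by linarith⟩
  have hv : R + 1 ∈ Icc R (R + 1) := ⟨by linarith, le_rfl⟩
  have hfc : ContinuousOn f (Icc R (R + 1)) :=
    ContinuousOn.div (by fun_prop) (by fun_prop) ht0
  have hdet := det_entries g
  -- The determinant is one and `P` lies to the left of `R`, so the image interval keeps its
  -- orientation and its length is explicit.
  have hdiff : (f (R + 1) - f R) * (g 1 0 ^ 2 * ((R - P) * (R + 1 - P))) = 1 := by
    have e1 := ht0 R hu
    have e2 := ht0 _ hv
    have : g 1 0 ^ 2 * ((R - P) * (R + 1 - P)) =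
        (g 1 0 * R + g 1 1) * (g 1 0 * (R + 1) + g 1 1) := by
      rw [hlin, hlin]
      ring
    rw [this]
    simp only [hf]
    rw [div_sub_div _ _ e2 e1, div_mul_eq_mul_div, div_eq_one_iff_eq (mul_ne_zero e2 e1)]
    linear_combination ((g 1 0 * R + g 1 1) * (g 1 0 * (R + 1) + g 1 1)) * hdet
  have hc2 : 0 < g 1 0 ^ 2 := by positivity
  have hPP : 0 < (R - P) * (R + 1 - P) := mul_pos (ht R hu).1 (ht _ hv).1
  have hlt : 0 < f (R + 1) - f R := by
    by_contra! h
    nlinarith [mul_pos hc2 hPP]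
  have himg : ∀ w ∈ Ioo (f R) (f (R + 1)), ∃ t ∈ Ioo R (R + 1),
      moebius (D.word L) ((t : ℂ) : OnePoint ℂ) = (w : ℂ) := fun w hw => by
    obtain ⟨t, ht1, rfl⟩ := intermediate_value_Ioo (by linarith) hfc hw
    exact ⟨t, ht1, hmf t (Ioo_subset_Icc_self ht1)⟩
  refine ⟨f R, f (R + 1), by linarith, himg, fun w hw => ?_, ?_⟩
  · obtain ⟨t, ht1, ht2⟩ := himg w hw
    have := word_mem_isoBall hD L hL (x := ((t : ℂ) : OnePoint ℂ)) (fun s _ => by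
        rw [coe_mem_image_iff]
        intro h
        have := hRb s _ h
        rw [Complex.norm_real, Real.norm_eq_abs] at this
        linarith [le_abs_self t, ht1.1]) (L.head hne) (by simp [List.head?_eq_some_head hne])
    rw [ht2, coe_mem_image_iff] at this
    have := hRb _ _ (D.isoBall_subset _ this)
    rw [Complex.norm_real, Real.norm_eq_abs, abs_lt] at this
    exact ⟨this.1, by linarith [this.2]⟩
  · have hx := attrImg_spec hD q (D.word L)
    have hy := repImg_spec hD q (D.word L)
    rw [← hg] at hx hy
    have hsub := moebius_sub g hx hy
    have hsub' : (D.attrImg q (D.word L) - D.repImg q (D.word L)) *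
        ((g 1 0 * D.attr q + g 1 1) * (g 1 0 * D.rep q + g 1 1)) = D.attr q - D.rep q := by
      exact_mod_cast hsub
    rw [hlin, hlin] at hsub'
    have hd1 : δ₁ ≤ |D.attr q - P| := by
      have := h₁ s (hq s hs) _ hP
      rwa [hPc, ← Complex.ofReal_sub, Complex.norm_real, Real.norm_eq_abs] at this
    have hd2 : δ₂ ≤ |D.rep q - P| := by
      have := h₂ s (hq s hs) _ hP
      rwa [hPc, ← Complex.ofReal_sub, Complex.norm_real, Real.norm_eq_abs] at this
    set X := |D.attrImg q (D.word L) - D.repImg q (D.word L)| with hX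
    have hX0 : 0 ≤ X := abs_nonneg _
    have habs := congrArg abs hsub'
    rw [abs_mul, abs_mul, abs_mul, abs_mul, ← hX, ← hK] at habs
    have e1 : X * (g 1 0 ^ 2 * (δ₁ * δ₂)) ≤ K := by
      rw [← habs, ← sq_abs (g 1 0)]
      calc X * (|g 1 0| ^ 2 * (δ₁ * δ₂))
          ≤ X * (|g 1 0| ^ 2 * (|D.attr q - P| * |D.rep q - P|)) := by gcongr
        _ = _ := by ring
    have e2 : 1 ≤ (f (R + 1) - f R) * (g 1 0 ^ 2 * (2 * R + 1) ^ 2) := by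
      refine hdiff.symm.le.trans ?_
      have : (R - P) * (R + 1 - P) ≤ (2 * R + 1) ^ 2 := by
        rw [sq]
        exact mul_le_mul (ht R hu).2 (ht _ hv).2 (ht _ hv).1.le (by linarith)
      gcongr
    have e3 : X ≤ K / (δ₁ * δ₂) / g 1 0 ^ 2 := by
      rw [div_div, le_div_iff₀ (by positivity)]
      linarith
    calc X ≤ K / (δ₁ * δ₂) / g 1 0 ^ 2 * 1 := by linarith
      _ ≤ K / (δ₁ * δ₂) / g 1 0 ^ 2 * ((f (R + 1) - f R) * (g 1 0 ^ 2 * (2 * R + 1) ^ 2)) := by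
        gcongr
      _ = K / (δ₁ * δ₂) * (2 * R + 1) ^ 2 * (f (R + 1) - f R) := by
        field_simp
      _ ≤ _ := by
        gcongr
        linarith

/-- The lengths `|γ(κ_{k,l}) - γ(κ_{l,k})|` are summable over the cosets of `⟨γ_{[k,l]}⟩`. -/
lemma summable_abs_sub (hD : D.DisjointIsometricCircles) (q : P₁ A) :
    Summable fun c : D.Gam ⧸ D.cyc q =>
      |D.attrImg q (D.word (D.repWord q c)) - D.repImg q (D.word (D.repWord q c))| := by
  obtain ⟨R, C, hR, h⟩ := exists_interval hD q
  choose u v huv himg hsub hle using fun c : D.Gam ⧸ D.cyc q =>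
    h (D.repWord q c) (repWord_spec q c).1 (repWord_spec q c).2.1
  refine Summable.of_nonneg_of_le (fun c => abs_nonneg _) hle (Summable.mul_left C ?_)
  refine summable_length_of_disjoint u v (-R) (R + 1) huv ?_ hsub
  intro c c' hcc
  refine Set.disjoint_left.mpr fun w hw hw' => hcc ?_
  obtain ⟨t, ht, h1⟩ := himg c w hw
  obtain ⟨t', ht', h2⟩ := himg c' w hw'
  have hout : ∀ t ∈ Ioo R (R + 1), ∀ s,
      ((t : ℂ) : OnePoint ℂ) ∉ ((↑) : ℂ → OnePoint ℂ) '' D.isoDisc s := by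
    intro t ht s
    rw [coe_mem_image_iff]
    intro hz
    have := hR s _ hz
    rw [Complex.norm_real, Real.norm_eq_abs] at this
    linarith [le_abs_self t, ht.1]
  -- A common point of two translated segments would make the two words the same group element,
  -- hence the cosets equal.
  have := eq_of_moebius_eq hD (hout t ht) (hout t' ht') (h1.trans h2.symm)
  rw [← (repWord_spec q c).2.2, this, (repWord_spec q c').2.2]

/-! ### The set of discontinuity -/

/-- A positive power of `γ_q` is a nonempty reduced word, so it moves `∞` into a disc and cannot be
the identity. -/
lemma genG_zpow_injective (hD : D.DisjointIsometricCircles) (q : P₁ A) :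
    Function.Injective fun n : ℤ => D.genG q ^ n := by
  rw [injective_zpow_iff_not_isOfFinOrder, isOfFinOrder_iff_pow_eq_one]
  rintro ⟨n, hn, h1⟩
  have hw : D.word (List.replicate n (q, true)) = 1 := by
    rw [word, List.map_replicate, List.prod_replicate]
    exact h1
  have hred : FreeGroup.IsReduced (List.replicate n (q, true)) :=
    List.isChain_replicate_of_rel _ fun _ => rfl
  have := word_mem_isoBall hD _ hred (x := OnePoint.infty) (fun s _ => infty_notMem_image _)
    (q, true) (by simp [List.head?_replicate, hn.ne'])
  rw [hw] at this
  simp at this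

/-- A point of the set of discontinuity stays away from the orbits of the fixed points of `γ_q`. -/
lemma exists_dist_of_fixed (hD : D.DisjointIsometricCircles) (q : P₁ A) {z : ℂ}
    (hz : (z : OnePoint ℂ) ∈ discontinuitySet D.Gam) :
    ∃ r : ℝ, 0 < r ∧ ∀ γ : D.Gam, ∀ x : OnePoint ℂ, moebius (D.gen q) x = x → ∀ w : ℂ,
      moebius γ x = w → r ≤ ‖z - w‖ := by
  obtain ⟨U, hU, hfin⟩ := hz
  have hU' : ((↑) : ℂ → OnePoint ℂ) ⁻¹' U ∈ 𝓝 z :=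
    OnePoint.continuous_coe.continuousAt.preimage_mem_nhds hU
  obtain ⟨r, hr, hb⟩ := Metric.mem_nhds_iff.mp hU'
  refine ⟨r, hr, fun γ x hx w hw => ?_⟩
  by_contra! h
  have hwU : (w : OnePoint ℂ) ∈ U := hb (by rwa [Metric.mem_ball', dist_eq_norm])
  have hfix : ∀ n : ℤ, moebius ((γ * D.genG q ^ n * γ⁻¹ : D.Gam) : PSL2R) (w : OnePoint ℂ) = w := by
    intro n
    have h1 : moebius ((γ⁻¹ : D.Gam) : PSL2R) (w : OnePoint ℂ) = x := by
      rw [← hw, Subgroup.coe_inv, map_inv]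
      exact Equiv.symm_apply_apply _ _
    have h2 : moebius ((D.genG q ^ n : D.Gam) : PSL2R) x = x := by
      rw [Subgroup.coe_zpow, map_zpow]
      exact Equiv.Perm.zpow_apply_eq_self_of_apply_eq_self hx n
    rw [Subgroup.coe_mul, map_mul, Equiv.Perm.mul_apply, h1, Subgroup.coe_mul, map_mul,
      Equiv.Perm.mul_apply, h2, hw]
  have hinj : Function.Injective fun n : ℤ => ((γ * D.genG q ^ n * γ⁻¹ : D.Gam) : PSL2R) := by
    intro m n hmn
    exact genG_zpow_injective hD q (mul_left_cancel (mul_right_cancel (Subtype.ext hmn)))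
  -- The infinitely many conjugates `γ γ_q^n γ⁻¹` all fix `w ∈ U`, against the finiteness in the
  -- definition of `Ω`.
  refine Set.infinite_range_of_injective hinj (hfin.subset ?_)
  rintro _ ⟨n, rfl⟩
  exact ⟨Subtype.coe_prop _, w, ⟨w, hwU, hfix n⟩, hwU⟩

lemma exists_dist_attrImg (hD : D.DisjointIsometricCircles) (q : P₁ A) {z : ℂ}
    (hz : (z : OnePoint ℂ) ∈ discontinuitySet D.Gam) :
    ∃ r : ℝ, 0 < r ∧ ∀ γ : D.Gam, r ≤ ‖z - D.attrImg q γ‖ ∧ r ≤ ‖z - D.repImg q γ‖ := by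
  obtain ⟨r, hr, h⟩ := exists_dist_of_fixed hD q hz
  exact ⟨r, hr, fun γ => ⟨h γ _ (D.gen_attrPt q) _ (attrImg_spec hD q γ),
    h γ _ (D.gen_repPt q) _ (repImg_spec hD q γ)⟩⟩

/-- The image of an isometric disc under a letter. -/
def subDisc (D : Params A) (s u : P₁ A × Bool) : Set (OnePoint ℂ) :=
  moebius (D.letter s) '' (((↑) : ℂ → OnePoint ℂ) '' D.isoDisc u)

lemma subDisc_subset (hD : D.DisjointIsometricCircles) {s u : P₁ A × Bool} (hsu : u ≠ s) :
    D.subDisc s u ⊆ ((↑) : ℂ → OnePoint ℂ) '' D.isoBall (opp s) := by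
  rintro _ ⟨x, hx, rfl⟩
  exact D.letter_mem_isoBall s (notMem_image_isoDisc hD hsu hx)

/-- The pole of a letter is the centre of its own isometric disc, so the letter is finite and
continuous on any other disc and the image is compact. -/
lemma isClosed_subDisc (hD : D.DisjointIsometricCircles) {s u : P₁ A × Bool} (hsu : u ≠ s) :
    IsClosed (D.subDisc s u) := by
  set g := D.letterSL s with hg
  have hc : g 1 0 ≠ 0 := D.letterSL_ne_zero s
  have hcc : ((g 1 0 : ℝ) : ℂ) ≠ 0 := by exact_mod_cast hc
  have h0 : ∀ z ∈ D.isoDisc u, (g 1 0 : ℂ) * z + (g 1 1 : ℂ) ≠ 0 := by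
    intro z hz h
    have h1 : z = isoCenter g := by
      rw [isoCenter]
      push_cast
      rw [eq_div_iff hcc]
      linear_combination h
    have h2 : z ∈ D.isoDisc s := by
      rw [isoDisc_eq, h1]
      exact Metric.mem_closedBall_self (isoRadius_pos _ hc).le
    exact Set.disjoint_left.mp (hD hsu) hz h2
  have heq : D.subDisc s u = (fun z : ℂ =>
      ((((g 0 0 : ℂ) * z + (g 0 1 : ℂ)) / ((g 1 0 : ℂ) * z + (g 1 1 : ℂ)) : ℂ) : OnePoint ℂ)) ''
        D.isoDisc u := by
    rw [subDisc, Set.image_image, letter_coe]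
    exact Set.image_congr fun z hz => moebius_coe_of_ne g z (h0 z hz)
  rw [heq]
  refine IsCompact.isClosed (IsCompact.image_of_continuousOn ?_ ?_)
  · rw [isoDisc_eq]
    exact isCompact_closedBall _ _
  · exact OnePoint.continuous_coe.comp_continuousOn
      (ContinuousOn.div (by fun_prop) (by fun_prop) h0)

/-- Points outside all the second-level discs belong to the set of discontinuity. -/
lemma mem_discontinuitySet_of_notMem_subDisc (hD : D.DisjointIsometricCircles) {x : OnePoint ℂ}
    (hx : ∀ s u, u ≠ s → x ∉ D.subDisc s u) : x ∈ discontinuitySet D.Gam := by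
  set U : Set (OnePoint ℂ) := ⋂ p : {p : (P₁ A × Bool) × (P₁ A × Bool) // p.2 ≠ p.1},
    (D.subDisc p.1.1 p.1.2)ᶜ with hUdef
  have hUo : IsOpen U :=
    isOpen_iInter_of_finite fun p => (isClosed_subDisc hD p.2).isOpen_compl
  have hmem : ∀ y, y ∈ U ↔ ∀ s u, u ≠ s → y ∉ D.subDisc s u := by
    intro y
    rw [hUdef, Set.mem_iInter]
    exact ⟨fun h s u hsu => h ⟨(s, u), hsu⟩, fun h p => h _ _ p.2⟩
  refine ⟨U, hUo.mem_nhds ((hmem x).mpr hx), ?_⟩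
  -- Only words with at most two letters can send a point of `U` into `U`; over a finite alphabet
  -- these are finitely many.
  have hfin : {L : List (P₁ A × Bool) | L.length < 3}.Finite := List.finite_length_lt _ 3
  refine (hfin.image fun L => (D.word L : PSL2R)).subset ?_
  rintro γ ⟨hγ, _, ⟨y, hy, rfl⟩, hγy⟩
  obtain ⟨L, hL, hw⟩ := D.exists_word ⟨γ, hγ⟩
  refine ⟨L, ?_, congrArg Subtype.val hw⟩
  by_contra hlen
  replace hlen : 3 ≤ L.length := not_lt.mp hlen
  have hγw : γ = D.word L := by rw [hw]
  rw [hγw] at hγy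
  obtain _ | ⟨s, L₁⟩ := L
  · simp at hlen
  obtain rfl | ⟨L₂, b, rfl⟩ := L₁.eq_nil_or_concat
  · simp at hlen
  obtain rfl | ⟨L₃, a, rfl⟩ := L₂.eq_nil_or_concat
  · simp at hlen
  have hab : a ≠ opp b := by
    have h : FreeGroup.IsReduced [a, b] := hL.infix ⟨s :: L₃, [], by simp⟩
    rw [FreeGroup.isReduced_cons_cons] at h
    rintro rfl
    have := h.1 rfl
    simp [opp] at this
  -- The word is now `s L₃ a b`. As `y` avoids the second-level disc `b⁻¹(disc a)`, the point `b y`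
  -- is outside disc `a`. So `L₃ a` sends it into the disc opposite to its first letter, and `s`
  -- then places it in a second-level disc, which `U` excludes.
  have hby : moebius (D.letter b) y ∉ ((↑) : ℂ → OnePoint ℂ) '' D.isoDisc a := by
    intro h
    refine (hmem y).mp hy (opp b) a hab ⟨_, h, ?_⟩
    rw [letter_opp, Subgroup.coe_inv, map_inv]
    exact Equiv.symm_apply_apply _ _
  have hred : FreeGroup.IsReduced (L₃ ++ [a]) := hL.infix ⟨[s], [b], by simp⟩
  obtain ⟨t, ht⟩ : ∃ t, t ∈ (L₃ ++ [a]).head? := by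
    cases L₃ <;> simp
  have h1 := word_mem_isoBall hD (L₃ ++ [a]) hred (x := moebius (D.letter b) y)
    (fun v hv => by
      obtain rfl : a = v := by simpa using hv
      exact hby) t ht
  have hst : opp t ≠ s := by
    obtain ⟨L₄, hL₄⟩ : ∃ L₄, L₃ ++ [a] = t :: L₄ := by
      cases h : L₃ ++ [a] with
      | nil => simp at h
      | cons v L₄ =>
        rw [h] at ht
        obtain rfl : v = t := by simpa using ht
        exact ⟨L₄, rfl⟩
    have h : FreeGroup.IsReduced (s :: t :: L₄) := hL.infix ⟨[], [b], by simp [← hL₄]⟩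
    rw [FreeGroup.isReduced_cons_cons] at h
    rintro rfl
    have := h.1 rfl
    simp [opp] at this
  refine (hmem _).mp hγy s (opp t) hst ⟨_, Set.image_mono (D.isoBall_subset _) h1, ?_⟩
  rw [word_cons, List.concat_eq_append, word_append (D := D) _ [b], List.concat_eq_append,
    word_cons (D := D) b, word_nil, mul_one]
  simp only [Subgroup.coe_mul, map_mul, Equiv.Perm.mul_apply]

/-- Every second-level disc lies in an open isometric disc, and no isometric circle meets any of
these. -/
lemma sphere_subset_discontinuitySet (hD : D.DisjointIsometricCircles) (s : P₁ A × Bool) {z : ℂ}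
    (hz : z ∈ Metric.sphere (isoCenter (D.letterSL s)) (isoRadius (D.letterSL s))) :
    (z : OnePoint ℂ) ∈ discontinuitySet D.Gam := by
  refine mem_discontinuitySet_of_notMem_subDisc hD fun t u htu h => ?_
  have h1 := subDisc_subset hD htu h
  rw [coe_mem_image_iff] at h1
  by_cases hs : opp t = s
  · subst hs
    exact (Metric.mem_ball.mp h1).ne (Metric.mem_sphere.mp hz)
  · have h2 : z ∈ D.isoDisc s := by
      rw [isoDisc_eq]
      exact Metric.sphere_subset_closedBall hz
    exact Set.disjoint_left.mp (hD hs) (D.isoBall_subset _ h1) h2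

/-! ### Convergence and holomorphy of the differential -/

lemma norm_seriesTerm_le (hD : D.DisjointIsometricCircles) (q : P₁ A) (c : D.Gam ⧸ D.cyc q)
    {z : ℂ} {δ : ℝ} (hδ : 0 < δ)
    (h : ∀ γ : D.Gam, δ ≤ ‖z - D.attrImg q γ‖ ∧ δ ≤ ‖z - D.repImg q γ‖) :
    ‖D.seriesTerm q c z‖ ≤
      |D.attrImg q (D.word (D.repWord q c)) - D.repImg q (D.word (D.repWord q c))| * (1 / δ ^ 2) := by
  rw [seriesTerm_eq hD]
  obtain ⟨h1, h2⟩ := h (D.word (D.repWord q c))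
  set x := D.attrImg q (D.word (D.repWord q c))
  set y := D.repImg q (D.word (D.repWord q c))
  have hx : z - x ≠ 0 := norm_pos_iff.mp (hδ.trans_le h1)
  have hy : z - y ≠ 0 := norm_pos_iff.mp (hδ.trans_le h2)
  have : 1 / (z - x) - 1 / (z - y) = ((x - y : ℝ) : ℂ) / ((z - x) * (z - y)) := by
    field_simp
    push_cast
    ring
  rw [this, norm_div, Complex.norm_real, Real.norm_eq_abs, norm_mul, mul_one_div]
  gcongr
  rw [sq]
  exact mul_le_mul h1 h2 hδ.le (norm_nonneg _)

lemma summable_seriesTerm (hD : D.DisjointIsometricCircles) (q : P₁ A)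
    {z : ℂ} {δ : ℝ} (hδ : 0 < δ)
    (h : ∀ γ : D.Gam, δ ≤ ‖z - D.attrImg q γ‖ ∧ δ ≤ ‖z - D.repImg q γ‖) :
    Summable fun c => ‖D.seriesTerm q c z‖ :=
  Summable.of_nonneg_of_le (fun _ => norm_nonneg _) (fun c => norm_seriesTerm_le hD q c hδ h)
    ((summable_abs_sub hD q).mul_right _)

/-- Half of the distance bound at `z` survives on a small ball, so the Weierstrass test applies
there. -/
lemma differentiableOn_omega (hD : D.DisjointIsometricCircles) (q : P₁ A) :
    DifferentiableOn ℂ (D.omega q) {z : ℂ | (z : OnePoint ℂ) ∈ discontinuitySet D.Gam} := by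
  intro z hz
  obtain ⟨r, hr, h⟩ := exists_dist_attrImg hD q hz
  have haway : ∀ w ∈ Metric.ball z (r / 2), ∀ γ : D.Gam,
      r / 2 ≤ ‖w - D.attrImg q γ‖ ∧ r / 2 ≤ ‖w - D.repImg q γ‖ := by
    intro w hw γ
    rw [mem_ball_iff_norm'] at hw
    have e1 := norm_sub_le_norm_sub_add_norm_sub z w (D.attrImg q γ)
    have e2 := norm_sub_le_norm_sub_add_norm_sub z w (D.repImg q γ)
    constructor <;> linarith [(h γ).1, (h γ).2]
  have hdiff : DifferentiableOn ℂ (fun w => ∑' c, D.seriesTerm q c w) (Metric.ball z (r / 2)) := by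
    refine Complex.differentiableOn_tsum_of_summable_norm
      ((summable_abs_sub hD q).mul_right (1 / (r / 2) ^ 2)) (fun c => ?_) Metric.isOpen_ball
      fun c w hw => norm_seriesTerm_le hD q c (half_pos hr) (haway w hw)
    refine DifferentiableOn.congr ?_ fun w _ => seriesTerm_eq hD q c w
    refine DifferentiableOn.sub (DifferentiableOn.div (by fun_prop) (by fun_prop) fun w hw => ?_)
      (DifferentiableOn.div (by fun_prop) (by fun_prop) fun w hw => ?_)
    · exact norm_pos_iff.mp ((half_pos hr).trans_le (haway w hw _).1)
    · exact norm_pos_iff.mp ((half_pos hr).trans_le (haway w hw _).2)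
  refine DifferentiableAt.differentiableWithinAt ?_
  exact (hdiff.differentiableAt (Metric.ball_mem_nhds z (half_pos hr))).const_mul _

end Params

/-! ### Logarithmic integrals along paths -/

lemma IsIntegrationPath.intervalIntegrable_mul {β : ℝ → ℂ} (hβ : IsIntegrationPath β) {a b : ℝ}
    (ha : 0 ≤ a) (hab : a ≤ b) (hb : b ≤ 1) {f : ℝ → ℂ} (hf : ContinuousOn f (Icc a b)) :
    IntervalIntegrable (fun t => f t * deriv β t) volume a b := by
  have h : IntervalIntegrable (deriv β) volume a b := hβ.integrable.mono_set (by
    rw [uIcc_of_le hab, uIcc_of_le zero_le_one]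
    exact Icc_subset_Icc ha hb)
  exact h.continuousOn_mul (by rwa [uIcc_of_le hab])

lemma IsIntegrationPath.continuousOn_inv {β : ℝ → ℂ} (hβ : IsIntegrationPath β) {x : ℂ}
    (hx : ∀ t ∈ Icc (0 : ℝ) 1, β t ≠ x) : ContinuousOn (fun t => 1 / (β t - x)) (Icc 0 1) :=
  ContinuousOn.div continuousOn_const (hβ.continuousOn.sub continuousOn_const)
    fun t ht => sub_ne_zero.mpr (hx t ht)

/-- Integral of `dz / (z - x)` along a piece of a path on which a branch of the logarithm exists. -/
lemma IsIntegrationPath.integral_inv_eq_log {β : ℝ → ℂ} (hβ : IsIntegrationPath β) {a b : ℝ}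
    (ha : 0 ≤ a) (hab : a ≤ b) (hb : b ≤ 1) {x w : ℂ} (hw : w ≠ 0)
    (hx : ∀ t ∈ Icc a b, (β t - x) / w ∈ Complex.slitPlane) :
    ∫ t in a..b, 1 / (β t - x) * deriv β t =
      Complex.log ((β b - x) / w) - Complex.log ((β a - x) / w) := by
  obtain ⟨S, hS, hdiff⟩ := hβ.differentiable
  have hsub : Icc a b ⊆ Icc (0 : ℝ) 1 := Icc_subset_Icc ha hb
  have hne : ∀ t ∈ Icc a b, β t - x ≠ 0 := fun t ht h => by
    have := Complex.slitPlane_ne_zero (hx t ht)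
    rw [h, zero_div] at this
    exact this rfl
  have hcont : ContinuousOn (fun t => (β t - x) / w) (Icc a b) :=
    ((hβ.continuousOn.mono hsub).sub continuousOn_const).div_const _
  refine integral_eq_of_hasDerivAt_off_countable_of_le
    (fun t => Complex.log ((β t - x) / w)) _ hab hS.countable (hcont.clog hx) (fun t ht => ?_) ?_
  · have hd : HasDerivAt β (deriv β t) t :=
      (hdiff t ⟨⟨ha.trans_lt ht.1.1, ht.1.2.trans_le hb⟩, ht.2⟩).hasDerivAt
    have h1 := ((hd.sub_const x).div_const w).clog_real (hx t (Ioo_subset_Icc_self ht.1))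
    rw [div_div_div_cancel_right₀ hw, ← one_div_mul_eq_div] at h1
    exact h1
  · exact hβ.intervalIntegrable_mul ha hab hb (ContinuousOn.div continuousOn_const
      ((hβ.continuousOn.mono hsub).sub continuousOn_const) hne)

/-- The exponential of the integral of `dz / (z - x)` along a path. -/
lemma IsIntegrationPath.exp_integral_inv {β : ℝ → ℂ} (hβ : IsIntegrationPath β) {x : ℂ}
    (hx : ∀ t ∈ Icc (0 : ℝ) 1, β t ≠ x) :
    Complex.exp (∫ t in (0 : ℝ)..1, 1 / (β t - x) * deriv β t) = (β 1 - x) / (β 0 - x) := by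
  have h0 : (0 : ℝ) ∈ Icc (0 : ℝ) 1 := ⟨le_rfl, zero_le_one⟩
  have h1 : (1 : ℝ) ∈ Icc (0 : ℝ) 1 := ⟨zero_le_one, le_rfl⟩
  have hint := hβ.intervalIntegrable_mul le_rfl zero_le_one le_rfl (hβ.continuousOn_inv hx)
  set F : ℝ → ℂ := fun s => ∫ t in (0 : ℝ)..s, 1 / (β t - x) * deriv β t with hF
  have hFc : ContinuousOn F (Icc 0 1) := by
    have := intervalIntegral.continuousOn_primitive_interval
      ((intervalIntegrable_iff_integrableOn_Icc_of_le zero_le_one enorm_ne_top).mp hint |> fun h => by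
        rwa [← uIcc_of_le (zero_le_one' ℝ)] at h)
    rwa [uIcc_of_le (zero_le_one' ℝ)] at this
  set s : Set ℝ := {t | Complex.exp (F t) * (β 0 - x) = β t - x} with hs
  have hclosed : IsClosed (s ∩ Icc 0 1) := by
    have hc : ContinuousOn (fun t => Complex.exp (F t) * (β 0 - x) - (β t - x)) (Icc 0 1) :=
      ((Complex.continuous_exp.comp_continuousOn hFc).mul continuousOn_const).sub
        (hβ.continuousOn.sub continuousOn_const)
    have := hc.preimage_isClosed_of_isClosed isClosed_Icc (isClosed_singleton (x := (0 : ℂ)))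
    convert this using 1
    ext t
    simp only [hs, Set.mem_inter_iff, Set.mem_preimage, Set.mem_singleton_iff, sub_eq_zero]
    exact and_comm
  have hsub : Icc (0 : ℝ) 1 ⊆ s := by
    -- Continuous induction: the set where the exponential identity holds is closed, and a local
    -- branch of the logarithm extends it to the right. No global branch along the path is needed.
    refine hclosed.Icc_subset_of_forall_exists_gt (by simp [hs, hF]) ?_
    rintro t ⟨hts, ht⟩ y hy
    have htI : t ∈ Icc (0 : ℝ) 1 := Ico_subset_Icc_self ht
    have hw : β t - x ≠ 0 := sub_ne_zero.mpr (hx t htI)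
    have hcw : ContinuousWithinAt (fun u => (β u - x) / (β t - x)) (Icc 0 1) t :=
      ((hβ.continuousOn.sub continuousOn_const).div_const _) t htI
    -- After division by `β t - x` the path starts at `1`, so it stays in the slit plane for a short
    -- time.
    have hev : ∀ᶠ u in 𝓝[Icc 0 1] t, (β u - x) / (β t - x) ∈ Complex.slitPlane := by
      refine hcw.eventually (Complex.isOpen_slitPlane.mem_nhds ?_)
      simp [div_self hw]
    obtain ⟨ε, hε, hb⟩ := Metric.mem_nhdsWithin_iff.mp hev
    set u := min (min y 1) (t + ε / 2) with hu
    have htu : t < u := lt_min (lt_min hy ht.2) (by linarith)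
    have huy : u ≤ y := (min_le_left _ _).trans (min_le_left _ _)
    have hu1 : u ≤ 1 := (min_le_left _ _).trans (min_le_right _ _)
    have hue : u ≤ t + ε / 2 := min_le_right _ _
    refine ⟨u, ?_, htu, huy⟩
    have hlog := hβ.integral_inv_eq_log ht.1 htu.le hu1 hw fun v hv => hb (by
      refine ⟨?_, ht.1.trans hv.1, hv.2.trans hu1⟩
      rw [Metric.mem_ball, Real.dist_eq, abs_lt]
      constructor <;> linarith [hv.1, hv.2])
    rw [div_self hw, Complex.log_one, sub_zero] at hlog
    have hadd : F u = F t + ∫ v in t..u, 1 / (β v - x) * deriv β v := by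
      refine (intervalIntegral.integral_add_adjacent_intervals ?_ ?_).symm
      · exact hβ.intervalIntegrable_mul le_rfl ht.1 htI.2
          ((hβ.continuousOn_inv hx).mono (Icc_subset_Icc_right htI.2))
      · exact hβ.intervalIntegrable_mul ht.1 htu.le hu1
          ((hβ.continuousOn_inv hx).mono (Icc_subset_Icc ht.1 hu1))
    have hwu : β u - x ≠ 0 := sub_ne_zero.mpr (hx u ⟨ht.1.trans htu.le, hu1⟩)
    change Complex.exp (F u) * (β 0 - x) = β u - x
    have hts' : Complex.exp (F t) * (β 0 - x) = β t - x := hts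
    rw [hadd, hlog, Complex.exp_add, Complex.exp_log (div_ne_zero hwu hw), mul_right_comm, hts']
    field_simp
  have h := hsub h1
  change Complex.exp (F 1) * (β 0 - x) = β 1 - x at h
  rw [eq_div_iff (sub_ne_zero.mpr (hx 0 h0)), h]

/-- The integral of `dz / (z - x)`, `x` real, along a path in the upper half-plane. -/
lemma IsIntegrationPath.integral_inv_of_upper {β : ℝ → ℂ} (hβ : IsIntegrationPath β)
    (hup : ∀ t ∈ Icc (0 : ℝ) 1, 0 < (β t).im) (x : ℝ) :
    ∫ t in (0 : ℝ)..1, 1 / (β t - x) * deriv β t =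
      Complex.log (β 1 - x) - Complex.log (β 0 - x) := by
  have := hβ.integral_inv_eq_log le_rfl zero_le_one le_rfl (x := x) one_ne_zero fun t ht => by
    rw [div_one, Complex.mem_slitPlane_iff]
    right
    simpa using (hup t ht).ne'
  simpa using this

lemma circleIntegral_inv_of_notMem {c x : ℂ} {R : ℝ} (hR : 0 ≤ R)
    (hx : x ∉ Metric.closedBall c R) : (∮ z in C(c, R), 1 / (z - x)) = 0 := by
  refine Complex.circleIntegral_eq_zero_of_differentiable_on_off_countable hR countable_empty
    ?_ fun z hz => ?_
  · exact ContinuousOn.div continuousOn_const (by fun_prop) fun z hz h => hx (by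
      rwa [← sub_eq_zero.mp h])
  · refine DifferentiableAt.div (by fun_prop) (by fun_prop) fun h => hx ?_
    rw [← sub_eq_zero.mp h]
    exact Metric.ball_subset_closedBall hz.1

namespace Params

variable {A : Matrix (Fin N) (Fin M) ℝ} {D : Params A}

/-- Countability is what the dominated convergence theorem for series asks of the index set. -/
instance countable_coset (q : P₁ A) : Countable (D.Gam ⧸ D.cyc q) := by
  have : Function.Surjective fun L : List (P₁ A × Bool) =>
      (QuotientGroup.mk (D.word L) : D.Gam ⧸ D.cyc q) := fun c =>
    ⟨D.repWord q c, (repWord_spec q c).2.2⟩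
  exact this.countable

/-- Term-by-term integration of the Poincaré series. -/
lemma hasSum_integral_seriesTerm (hD : D.DisjointIsometricCircles) (q : P₁ A) {a b : ℝ}
    (hab : a ≤ b) {β w : ℝ → ℂ} (hβ : ContinuousOn β (Icc a b)) (hw : IntervalIntegrable w volume a b)
    {δ : ℝ} (hδ : 0 < δ) (h : ∀ t ∈ Icc a b, ∀ γ : D.Gam,
      δ ≤ ‖β t - D.attrImg q γ‖ ∧ δ ≤ ‖β t - D.repImg q γ‖) :
    HasSum (fun c => ∫ t in a..b, D.seriesTerm q c (β t) * w t)
      (∫ t in a..b, (∑' c, D.seriesTerm q c (β t)) * w t) := by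
  have hsub : uIoc a b ⊆ Icc a b := by
    rw [uIoc_of_le hab]
    exact Ioc_subset_Icc_self
  set ℓ := fun c : D.Gam ⧸ D.cyc q =>
    |D.attrImg q (D.word (D.repWord q c)) - D.repImg q (D.word (D.repWord q c))| * (1 / δ ^ 2)
    with hℓ
  have hsum : Summable ℓ := (summable_abs_sub hD q).mul_right _
  refine intervalIntegral.hasSum_integral_of_dominated_convergence
    (fun c t => ℓ c * ‖w t‖) (fun c => ?_) (fun c => ?_) ?_ ?_ ?_
  · have hc : ContinuousOn (fun t => D.seriesTerm q c (β t)) (Icc a b) := by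
      refine ContinuousOn.congr ?_ fun t _ => seriesTerm_eq hD q c (β t)
      refine ContinuousOn.sub (ContinuousOn.div (by fun_prop) (by fun_prop) fun t ht => ?_)
        (ContinuousOn.div (by fun_prop) (by fun_prop) fun t ht => ?_)
      · exact norm_pos_iff.mp (hδ.trans_le (h t ht _).1)
      · exact norm_pos_iff.mp (hδ.trans_le (h t ht _).2)
    exact ((hc.mono hsub).aestronglyMeasurable measurableSet_uIoc).mul
      (by rw [uIoc_of_le hab]; exact hw.aestronglyMeasurable)
  · refine Filter.Eventually.of_forall fun t ht => ?_
    rw [norm_mul]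
    exact mul_le_mul_of_nonneg_right (norm_seriesTerm_le hD q c hδ (h t (hsub ht))) (norm_nonneg _)
  · exact Filter.Eventually.of_forall fun t _ => hsum.mul_right _
  · simp only [tsum_mul_right]
    exact hw.norm.const_mul _
  · refine Filter.Eventually.of_forall fun t ht => ?_
    exact ((summable_seriesTerm hD q hδ (h t (hsub ht))).of_norm.hasSum).mul_right _

end Params

/-! ### Telescoping sums of logarithms -/

/-- The ratio `(a - μⁿ X) / (a - μⁿ Y)`. -/
def orbitRatio (μ X Y : ℝ) (a : ℂ) (n : ℤ) : ℂ :=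
  (a - ((μ ^ n * X : ℝ) : ℂ)) / (a - ((μ ^ n * Y : ℝ) : ℂ))

lemma tendsto_orbitRatio_atTop {μ X Y : ℝ} {a : ℂ} (h0 : 0 < μ) (h1 : μ < 1) (ha : a ≠ 0) :
    Filter.Tendsto (fun n : ℕ => orbitRatio μ X Y a n) Filter.atTop (𝓝 1) := by
  have hμ : Filter.Tendsto (fun n : ℕ => μ ^ (n : ℤ)) Filter.atTop (𝓝 0) := by
    simpa using tendsto_pow_atTop_nhds_zero_of_lt_one h0.le h1
  have hlim : ∀ Z : ℝ, Filter.Tendsto (fun n : ℕ => a - ((μ ^ (n : ℤ) * Z : ℝ) : ℂ))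
      Filter.atTop (𝓝 a) := fun Z => by
    have := (Complex.continuous_ofReal.tendsto _).comp (hμ.mul_const Z)
    simpa using this.const_sub a
  have h := (hlim X).div (hlim Y) ha
  rwa [div_self ha] at h

lemma tendsto_orbitRatio_atBot {μ X Y : ℝ} {a : ℂ} (h0 : 0 < μ) (h1 : μ < 1) (hY : Y ≠ 0) :
    Filter.Tendsto (fun n : ℕ => orbitRatio μ X Y a (-(n : ℤ))) Filter.atTop (𝓝 (X / Y)) := by
  have hμ : Filter.Tendsto (fun n : ℕ => ((μ ^ n : ℝ) : ℂ)) Filter.atTop (𝓝 0) := by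
    have := (Complex.continuous_ofReal.tendsto _).comp
      (tendsto_pow_atTop_nhds_zero_of_lt_one h0.le h1)
    simpa [Function.comp_def] using this
  have hlim : ∀ Z : ℝ, Filter.Tendsto (fun n : ℕ => ((μ ^ n : ℝ) : ℂ) * a - Z)
      Filter.atTop (𝓝 (-(Z : ℂ))) := fun Z => by
    simpa using (hμ.mul_const a).sub_const (Z : ℂ)
  have hY' : -(Y : ℂ) ≠ 0 := neg_ne_zero.mpr (by exact_mod_cast hY)
  have h := (hlim X).div (hlim Y) hY'
  rw [neg_div_neg_eq] at h
  refine h.congr fun n => ?_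
  -- Numerator and denominator both blow up; multiplying them by `μ ^ n` gives finite limits.
  have hn : ((μ ^ n : ℝ) : ℂ) ≠ 0 := by exact_mod_cast (pow_pos h0 n).ne'
  have key : ∀ Z : ℝ, ((μ ^ n : ℝ) : ℂ) * a - Z =
      ((μ ^ n : ℝ) : ℂ) * (a - ((μ ^ (-(n : ℤ)) * Z : ℝ) : ℂ)) := fun Z => by
    rw [zpow_neg, zpow_natCast, mul_sub, ← Complex.ofReal_mul, ← mul_assoc,
      mul_inv_cancel₀ (pow_pos h0 n).ne', one_mul]
  rw [orbitRatio, Pi.div_apply, key, key, mul_div_mul_left _ _ hn]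

/-- Pairing `n + 1` with `-n` makes the partial sums run over `-K + 1, …, K`, so a telescoping sum
leaves exactly the values at `-K` and `K`. -/
lemma hasSum_shift_pairs {T : ℤ → ℂ} {F : ℂ} (hT : HasSum T F) :
    Filter.Tendsto (fun K : ℕ => ∑ n ∈ Finset.range K, (T (n + 1) + T (-(n : ℤ)))) Filter.atTop
      (𝓝 F) := by
  have h1 : HasSum (fun n : ℤ => T (n + 1)) F := (Equiv.addRight (1 : ℤ)).hasSum_iff.mpr hT
  have h2 := h1.nat_add_neg_add_one.tendsto_sum_nat
  simpa using h2

lemma telescope_exp {μ X Y : ℝ} {a : ℂ} (h0 : 0 < μ) (h1 : μ < 1) (ha : a ≠ 0)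
    (hY : Y ≠ 0) (hne : ∀ n : ℤ, orbitRatio μ X Y a n ≠ 0) {T : ℤ → ℂ} {F : ℂ} (hT : HasSum T F)
    (hexp : ∀ n, Complex.exp (T n) = orbitRatio μ X Y a (n - 1) / orbitRatio μ X Y a n) :
    Complex.exp F = X / Y := by
  have hpart : ∀ K : ℕ, Complex.exp (∑ n ∈ Finset.range K, (T (n + 1) + T (-(n : ℤ)))) =
      orbitRatio μ X Y a (-(K : ℤ)) / orbitRatio μ X Y a K := by
    intro K
    induction K with
    | zero => simp [div_self (hne 0)]
    | succ K ih =>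
      rw [Finset.sum_range_succ, Complex.exp_add, Complex.exp_add, ih, hexp, hexp]
      have e1 : ((K : ℤ) + 1 - 1) = K := by ring
      have e2 : (-(K : ℤ) - 1) = -((K + 1 : ℕ) : ℤ) := by push_cast; ring
      rw [e1, e2]
      have := hne K
      have := hne (-(K : ℤ))
      have := hne ((K : ℤ) + 1)
      push_cast
      field_simp
  have hlim := (Complex.continuous_exp.tendsto F).comp (hasSum_shift_pairs hT)
  have hlim2 := (tendsto_orbitRatio_atBot (X := X) (a := a) h0 h1 hY).div
    (tendsto_orbitRatio_atTop (X := X) (Y := Y) h0 h1 ha) one_ne_zero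
  rw [div_one] at hlim2
  exact tendsto_nhds_unique hlim (hlim2.congr fun K => (hpart K).symm)

/-- The sign of this imaginary part does not depend on `n`: the whole orbit of ratios stays in one
half-plane. -/
lemma im_orbitRatio {μ X Y : ℝ} {a : ℂ} (n : ℤ) : (orbitRatio μ X Y a n).im =
    μ ^ n * (X - Y) * a.im / Complex.normSq (a - ((μ ^ n * Y : ℝ) : ℂ)) := by
  rw [orbitRatio, Complex.div_im, ← sub_div]
  simp only [Complex.sub_re, Complex.sub_im, Complex.ofReal_re, Complex.ofReal_im]
  ring

lemma normSq_orbit_pos {a : ℂ} (ha : a.im < 0) (x : ℝ) : 0 < Complex.normSq (a - (x : ℂ)) := by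
  refine Complex.normSq_pos.mpr fun h => ?_
  have := congrArg Complex.im h
  simp at this
  exact ha.ne this

lemma im_orbitRatio_pos {μ X Y : ℝ} {a : ℂ} (h0 : 0 < μ) (ha : a.im < 0) (h : X < Y) (n : ℤ) :
    0 < (orbitRatio μ X Y a n).im := by
  rw [im_orbitRatio]
  refine div_pos ?_ (normSq_orbit_pos ha _)
  exact mul_pos_of_neg_of_neg (mul_neg_of_pos_of_neg (zpow_pos h0 n) (sub_neg.mpr h)) ha

lemma im_orbitRatio_neg {μ X Y : ℝ} {a : ℂ} (h0 : 0 < μ) (ha : a.im < 0) (h : Y < X) (n : ℤ) :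
    (orbitRatio μ X Y a n).im < 0 := by
  rw [im_orbitRatio]
  refine div_neg_of_neg_of_pos ?_ (normSq_orbit_pos ha _)
  exact mul_neg_of_pos_of_neg (mul_pos (zpow_pos h0 n) (sub_pos.mpr h)) ha

/-- The limit of the logarithms of the ratios, from inside a half-plane. -/
lemma tendsto_log_orbitRatio_atBot {μ X Y : ℝ} {a : ℂ} (h0 : 0 < μ) (h1 : μ < 1) (ha : a.im < 0)
    (hX : X ≠ 0) (hY : Y ≠ 0) :
    Filter.Tendsto (fun n : ℕ => Complex.log (orbitRatio μ X Y a (-(n : ℤ)))) Filter.atTop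
      (𝓝 (Complex.log ((X : ℂ) / Y) - if Y < 0 ∧ 0 < X then 2 * π * I else 0)) := by
  have hlim := tendsto_orbitRatio_atBot (X := X) (a := a) h0 h1 hY
  rw [← Complex.ofReal_div] at hlim ⊢
  have him : ((X / Y : ℝ) : ℂ).im = 0 := Complex.ofReal_im _
  rcases lt_or_gt_of_ne (div_ne_zero hX hY) with hneg | hpos
  · have hre : ((X / Y : ℝ) : ℂ).re < 0 := hneg
    have hval : Complex.log ((X / Y : ℝ) : ℂ) = Real.log ‖((X / Y : ℝ) : ℂ)‖ + π * I := by
      rw [Complex.log, Complex.arg_eq_pi_iff.mpr ⟨hre, him⟩]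
    rw [hval]
    rcases div_neg_iff.mp hneg with ⟨hx, hy⟩ | ⟨hx, hy⟩
    · rw [if_pos ⟨hy, hx⟩]
      -- For `Y < 0 < X` the negative limit is approached from below, where the logarithm tends to
      -- `ln |X/Y| - πi`, which is `2πi` less than its principal value.
      have hw : Filter.Tendsto (fun n : ℕ => orbitRatio μ X Y a (-(n : ℤ))) Filter.atTop
          (𝓝[{z : ℂ | z.im < 0}] ((X / Y : ℝ) : ℂ)) :=
        tendsto_nhdsWithin_iff.mpr ⟨hlim, Filter.Eventually.of_forall fun n =>
          im_orbitRatio_neg h0 ha (hy.trans hx) _⟩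
      rw [show (Real.log ‖((X / Y : ℝ) : ℂ)‖ : ℂ) + π * I - 2 * π * I =
        Real.log ‖((X / Y : ℝ) : ℂ)‖ - π * I by ring]
      exact (Complex.tendsto_log_nhdsWithin_im_neg_of_re_neg_of_im_zero hre him).comp hw
    · rw [if_neg (fun h => lt_asymm hx h.2), sub_zero]
      have hw : Filter.Tendsto (fun n : ℕ => orbitRatio μ X Y a (-(n : ℤ))) Filter.atTop
          (𝓝[{z : ℂ | 0 ≤ z.im}] ((X / Y : ℝ) : ℂ)) :=
        tendsto_nhdsWithin_iff.mpr ⟨hlim, Filter.Eventually.of_forall fun n =>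
          (im_orbitRatio_pos h0 ha (hx.trans hy) _).le⟩
      exact (Complex.tendsto_log_nhdsWithin_im_nonneg_of_re_neg_of_im_zero hre him).comp hw
  · rw [if_neg, sub_zero]
    · exact hlim.clog (Complex.ofReal_mem_slitPlane.mpr hpos)
    · rintro ⟨hy, hx⟩
      exact lt_asymm hpos (div_neg_of_pos_of_neg hx hy)

lemma telescope_log {μ X Y : ℝ} {a : ℂ} (h0 : 0 < μ) (h1 : μ < 1) (ha : a.im < 0) (hX : X ≠ 0)
    (hY : Y ≠ 0) {T : ℤ → ℂ} {F : ℂ} (hT : HasSum T F)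
    (hlog : ∀ n, T n =
      Complex.log (orbitRatio μ X Y a (n - 1)) - Complex.log (orbitRatio μ X Y a n)) :
    F = Complex.log ((X : ℂ) / Y) - if Y < 0 ∧ 0 < X then 2 * π * I else 0 := by
  have ha0 : a ≠ 0 := by
    rintro rfl
    simp at ha
  have hpart : ∀ K : ℕ, ∑ n ∈ Finset.range K, (T (n + 1) + T (-(n : ℤ))) =
      Complex.log (orbitRatio μ X Y a (-(K : ℤ))) - Complex.log (orbitRatio μ X Y a K) := by
    intro K
    induction K with
    | zero => simp
    | succ K ih =>
      rw [Finset.sum_range_succ, ih, hlog, hlog]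
      have e1 : ((K : ℤ) + 1 - 1) = K := by ring
      have e2 : (-(K : ℤ) - 1) = -((K + 1 : ℕ) : ℤ) := by push_cast; ring
      rw [e1, e2]
      push_cast
      ring
  have hlim2 := (tendsto_log_orbitRatio_atBot h0 h1 ha hX hY).sub
    ((tendsto_orbitRatio_atTop (X := X) (Y := Y) h0 h1 ha0).clog Complex.one_mem_slitPlane)
  rw [Complex.log_one, sub_zero] at hlim2
  exact tendsto_nhds_unique (hasSum_shift_pairs hT) (hlim2.congr fun K => (hpart K).symm)

/-- Two points of the same half-plane. -/
def SameSide (u v : ℂ) : Prop := (0 < u.im ∧ 0 < v.im) ∨ (u.im < 0 ∧ v.im < 0)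

/-- Negation shifts both arguments by the same `±π`, because the points are in the same half-plane.
-/
lemma log_neg_sub_log_neg {u v : ℂ} (h : SameSide u v) :
    Complex.log (-u) - Complex.log (-v) = Complex.log u - Complex.log v := by
  rcases h with ⟨hu, hv⟩ | ⟨hu, hv⟩
  · rw [Complex.log, Complex.log, Complex.log, Complex.log, norm_neg, norm_neg,
      Complex.arg_neg_eq_arg_sub_pi_of_im_pos hu, Complex.arg_neg_eq_arg_sub_pi_of_im_pos hv]
    push_cast
    ring
  · rw [Complex.log, Complex.log, Complex.log, Complex.log, norm_neg, norm_neg,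
      Complex.arg_neg_eq_arg_add_pi_of_im_neg hu, Complex.arg_neg_eq_arg_add_pi_of_im_neg hv]
    push_cast
    ring

/-- This removes the real factor left by the change of coordinate, whose sign is not controlled. -/
lemma log_real_mul_sub {u v : ℂ} (h : SameSide u v) {k : ℝ} (hk : k ≠ 0) :
    Complex.log (k * u) - Complex.log (k * v) = Complex.log u - Complex.log v := by
  have hu : u ≠ 0 := by
    rintro rfl
    rcases h with h | h <;> simp at h
  have hv : v ≠ 0 := by
    rintro rfl
    rcases h with h | h <;> simp at h
  rcases lt_or_gt_of_ne hk with hk | hk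
  · have e : ∀ w : ℂ, (k : ℂ) * w = ((-k : ℝ) : ℂ) * (-w) := fun w => by push_cast; ring
    rw [e, e, Complex.log_ofReal_mul (neg_pos.mpr hk) (neg_ne_zero.mpr hu),
      Complex.log_ofReal_mul (neg_pos.mpr hk) (neg_ne_zero.mpr hv), ← log_neg_sub_log_neg h]
    ring
  · rw [Complex.log_ofReal_mul hk hu, Complex.log_ofReal_mul hk hv]
    ring

/-- Both arguments lie in `(0, π)`, so their difference lies in the principal range. -/
lemma log_sub_log_of_upper {u v : ℂ} (hu : 0 < u.im) (hv : 0 < v.im) :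
    Complex.log u - Complex.log v = Complex.log (u / v) := by
  have hu0 : u ≠ 0 := by
    rintro rfl
    simp at hu
  have hv0 : v ≠ 0 := by
    rintro rfl
    simp at hv
  have h1 : 0 ≤ u.arg := Complex.arg_nonneg_iff.mpr hu.le
  have h2 : v.arg < π := Complex.arg_lt_pi_iff.mpr (Or.inr hv.ne')
  have h3 : u.arg ≤ π := Complex.arg_le_pi u
  have h4 : 0 ≤ v.arg := Complex.arg_nonneg_iff.mpr hv.le
  have him : (Complex.log u - Complex.log v).im = u.arg - v.arg := by
    simp [Complex.log_im]
  rw [← Complex.log_exp (x := Complex.log u - Complex.log v) (by rw [him]; linarith)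
    (by rw [him]; linarith), Complex.exp_sub, Complex.exp_log hu0, Complex.exp_log hv0]

namespace Params

variable {A : Matrix (Fin N) (Fin M) ℝ} {D : Params A}

/-- The distance to the set of image points is continuous and attains its minimum on `K` at a point
of `Ω`, where it is positive. -/
lemma exists_dist_of_isCompact (hD : D.DisjointIsometricCircles) (q : P₁ A) {K : Set ℂ}
    (hK : IsCompact K) (hKd : ∀ z ∈ K, (z : OnePoint ℂ) ∈ discontinuitySet D.Gam) :
    ∃ δ : ℝ, 0 < δ ∧ ∀ z ∈ K, ∀ γ : D.Gam,
      δ ≤ ‖z - D.attrImg q γ‖ ∧ δ ≤ ‖z - D.repImg q γ‖ := by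
  rcases K.eq_empty_or_nonempty with rfl | hne
  · exact ⟨1, one_pos, by simp⟩
  set Z : Set ℂ := Set.range (fun γ : D.Gam => (D.attrImg q γ : ℂ)) ∪
    Set.range (fun γ : D.Gam => (D.repImg q γ : ℂ)) with hZ
  have hZne : Z.Nonempty := ⟨_, Or.inl ⟨1, rfl⟩⟩
  obtain ⟨z₀, hz₀, hmin⟩ := hK.exists_isMinOn hne
    (Metric.continuous_infDist_pt Z).continuousOn
  obtain ⟨r, hr, h⟩ := exists_dist_attrImg hD q (hKd z₀ hz₀)
  have hle : r ≤ Metric.infDist z₀ Z := by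
    refine (Metric.le_infDist hZne).mpr ?_
    rintro _ (⟨γ, rfl⟩ | ⟨γ, rfl⟩)
    · rw [dist_eq_norm]
      exact (h γ).1
    · rw [dist_eq_norm]
      exact (h γ).2
  refine ⟨r, hr, fun z hz γ => ⟨?_, ?_⟩⟩
  · rw [← dist_eq_norm]
    exact (hle.trans (hmin hz)).trans (Metric.infDist_le_dist_of_mem (Or.inl ⟨γ, rfl⟩))
  · rw [← dist_eq_norm]
    exact (hle.trans (hmin hz)).trans (Metric.infDist_le_dist_of_mem (Or.inr ⟨γ, rfl⟩))

/-! ### The periods over the isometric circles -/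

open Classical in
lemma circleIntegral_inv_of_mem_isoBall (hD : D.DisjointIsometricCircles) (s u : P₁ A × Bool)
    {x : ℂ} (hx : x ∈ D.isoBall u) :
    (∮ z in C(isoCenter (D.letterSL s), isoRadius (D.letterSL s)), 1 / (z - x)) =
      if u = s then 2 * π * I else 0 := by
  split_ifs with h
  · subst h
    simpa using circleIntegral.integral_sub_inv_of_mem_ball hx
  · refine circleIntegral_inv_of_notMem (isoRadius_pos _ (D.letterSL_ne_zero s)).le ?_
    rw [← isoDisc_eq]
    exact Set.disjoint_left.mp (hD h) (D.isoBall_subset _ hx)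

lemma circleIntegrable_inv_of_mem_isoBall (hD : D.DisjointIsometricCircles) (s u : P₁ A × Bool)
    {x : ℂ} (hx : x ∈ D.isoBall u) :
    CircleIntegrable (fun z => 1 / (z - x)) (isoCenter (D.letterSL s)) (isoRadius (D.letterSL s)) := by
  refine ContinuousOn.circleIntegrable (isoRadius_pos _ (D.letterSL_ne_zero s)).le
    (ContinuousOn.div continuousOn_const (by fun_prop) fun z hz h => ?_)
  rw [sub_eq_zero.mp h] at hz
  by_cases hu : u = s
  · subst hu
    exact (Metric.mem_ball.mp hx).ne (Metric.mem_sphere.mp hz)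
  · refine Set.disjoint_left.mp (hD hu) (D.isoBall_subset _ hx) ?_
    rw [isoDisc_eq]
    exact Metric.sphere_subset_closedBall hz

open Classical in
lemma circleIntegral_seriesTerm (hD : D.DisjointIsometricCircles) (q : P₁ A) (s : P₁ A × Bool)
    (γ : D.Gam) {u v : P₁ A × Bool} (hu : (D.attrImg q γ : ℂ) ∈ D.isoBall u)
    (hv : (D.repImg q γ : ℂ) ∈ D.isoBall v) :
    (∮ z in C(isoCenter (D.letterSL s), isoRadius (D.letterSL s)),
      D.seriesTerm q (QuotientGroup.mk γ) z) =
      (if u = s then 2 * π * I else 0) - (if v = s then 2 * π * I else 0) := by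
  simp only [seriesTerm_mk hD]
  rw [circleIntegral.integral_sub (circleIntegrable_inv_of_mem_isoBall hD s u hu)
    (circleIntegrable_inv_of_mem_isoBall hD s v hv), circleIntegral_inv_of_mem_isoBall hD s u hu,
    circleIntegral_inv_of_mem_isoBall hD s v hv]

open Classical in
lemma circleIntegral_omega (hD : D.DisjointIsometricCircles) (q : P₁ A) (s : P₁ A × Bool) :
    (∮ z in C(isoCenter (D.letterSL s), isoRadius (D.letterSL s)), D.omega q z) =
      (if (q, false) = s then 1 else 0) - (if (q, true) = s then 1 else 0) := by
  set c := isoCenter (D.letterSL s) with hc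
  set R := isoRadius (D.letterSL s) with hR
  have hR0 : 0 ≤ R := (isoRadius_pos _ (D.letterSL_ne_zero s)).le
  obtain ⟨δ, hδ, h⟩ := exists_dist_of_isCompact hD q (isCompact_sphere c R)
    fun z hz => sphere_subset_discontinuitySet hD s hz
  have hsum := hasSum_integral_seriesTerm hD q (a := 0) (b := 2 * π) (by positivity)
    (β := circleMap c R) (w := deriv (circleMap c R)) (continuous_circleMap c R).continuousOn
    (by
      refine Continuous.intervalIntegrable ?_ _ _
      rw [show deriv (circleMap c R) = fun t => circleMap 0 R t * I from
        funext (deriv_circleMap c R)]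
      fun_prop) hδ fun t _ => h _ (circleMap_mem_sphere c hR0 t)
  have hconv : ∀ f : ℂ → ℂ, (∫ t in (0 : ℝ)..2 * π, f (circleMap c R t) * deriv (circleMap c R) t)
      = ∮ z in C(c, R), f z := fun f => by
    simp only [circleIntegral, smul_eq_mul, mul_comm]
  simp only [hconv, hconv fun z => ∑' c, D.seriesTerm q c z] at hsum
  have hone : (∮ z in C(c, R), ∑' c, D.seriesTerm q c z) =
      ∮ z in C(c, R), D.seriesTerm q (QuotientGroup.mk 1) z := by
    refine hsum.unique ?_
    -- A nonidentity coset has a nonempty representing word, which sends both fixed points into one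
    -- disc; their residues cancel.
    refine hasSum_single _ fun c' hc' => ?_
    obtain ⟨h1, h2, h3⟩ := repWord_spec q c'
    obtain ⟨t, L, hL⟩ : ∃ t L, D.repWord q c' = t :: L := by
      cases hw : D.repWord q c' with
      | nil =>
        rw [hw, word_nil] at h3
        exact absurd h3.symm hc'
      | cons t L => exact ⟨t, L, rfl⟩
    have e1 := word_attrPt_mem hD h1 h2 t (by simp [hL])
    have e2 := word_repPt_mem hD h1 h2 t (by simp [hL])
    rw [attrImg_spec hD, coe_mem_image_iff] at e1
    rw [repImg_spec hD, coe_mem_image_iff] at e2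
    rw [← h3, circleIntegral_seriesTerm hD q s _ e1 e2, sub_self]
  have hpi : (2 * π * I : ℂ) ≠ 0 := Complex.two_pi_I_ne_zero
  simp only [omega]
  rw [circleIntegral.integral_const_mul, hone, circleIntegral_seriesTerm hD q s 1
    (u := (q, false)) (v := (q, true)) (by rw [attrImg_one]; exact D.attr_mem_isoBall q)
    (by rw [repImg_one]; exact D.rep_mem_isoBall q), mul_sub]
  congr 1 <;> split_ifs
  · exact one_div_mul_cancel hpi
  · exact mul_zero _
  · exact one_div_mul_cancel hpi
  · exact mul_zero _

/-! ### The coordinate in which `γ_{[i,j]}` is a dilation -/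

variable (D) in
/-- The coordinate `(z - κ_{i,j}) / (z - κ_{j,i})`. -/
def cay (p : P₁ A) (z : ℂ) : ℂ := (z - D.attr p) / (z - D.rep p)

variable (D) in
/-- The coordinate `(x - κ_{i,j}) / (x - κ_{j,i})` of a real point. -/
def cayR (p : P₁ A) (x : ℝ) : ℝ := (x - D.attr p) / (x - D.rep p)

lemma ofReal_cayR (p : P₁ A) (x : ℝ) : ((D.cayR p x : ℝ) : ℂ) = D.cay p x := by
  simp [cayR, cay]

lemma cay_gen (p : P₁ A) {z w : ℂ} (hz : z ≠ D.rep p)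
    (h : moebius (D.gen p) (z : OnePoint ℂ) = w) :
    w ≠ D.rep p ∧ D.cay p w = D.mult p * D.cay p z := by
  have hw : w ≠ D.rep p := by
    rintro rfl
    exact hz (OnePoint.coe_injective ((moebius (D.gen p)).injective (h.trans (D.gen_repPt p).symm)))
  refine ⟨hw, ?_⟩
  have := D.gen_relation p z w h
  rw [cay, cay, ← mul_div_assoc, div_eq_div_iff (sub_ne_zero.mpr hw) (sub_ne_zero.mpr hz)]
  exact this

/-- The action of the powers of `γ_{[i,j]}` on a real orbit. -/
lemma cayR_zpow_mul {P : OnePoint ℂ} {f : D.Gam → ℝ}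
    (hf : ∀ γ : D.Gam, moebius γ P = ((f γ : ℂ) : OnePoint ℂ)) (p : P₁ A) {γ : D.Gam}
    (h : f γ ≠ D.rep p) (m : ℤ) : f (D.genG p ^ m * γ) ≠ D.rep p ∧
      D.cayR p (f (D.genG p ^ m * γ)) = D.mult p ^ m * D.cayR p (f γ) := by
  have hne : ∀ m : ℤ, f (D.genG p ^ m * γ) ≠ D.rep p := by
    intro m hm
    have h1 : moebius ((D.genG p ^ m : D.Gam) : PSL2R) ((f γ : ℂ) : OnePoint ℂ) = D.repPt p := by
      rw [← hf, ← Equiv.Perm.mul_apply, ← map_mul, ← Subgroup.coe_mul, hf, hm]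
      rfl
    have h2 := (moebius ((D.genG p ^ m : D.Gam) : PSL2R)).injective
      (h1.trans (D.gen_zpow_repPt p m).symm)
    exact h (by exact_mod_cast OnePoint.coe_injective h2)
  have hstep : ∀ m : ℤ, D.cayR p (f (D.genG p ^ (m + 1) * γ)) =
      D.mult p * D.cayR p (f (D.genG p ^ m * γ)) := by
    intro m
    have h1 : moebius (D.gen p) ((f (D.genG p ^ m * γ) : ℂ) : OnePoint ℂ) =
        ((f (D.genG p ^ (m + 1) * γ) : ℂ) : OnePoint ℂ) := by
      rw [← hf, ← hf, add_comm, zpow_add, zpow_one, mul_assoc, Subgroup.coe_mul (y := D.genG p ^ m * γ),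
        map_mul, Equiv.Perm.mul_apply]
      rfl
    have h2 := (cay_gen p (by exact_mod_cast hne m) h1).2
    rw [← ofReal_cayR, ← ofReal_cayR] at h2
    exact_mod_cast h2
  have hμ := (D.mult_pos p).ne'
  refine ⟨hne m, ?_⟩
  induction m using Int.induction_on with
  | zero => simp
  | succ n ih => rw [hstep, ih, zpow_add_one₀ hμ]; ring
  | pred n ih =>
    have h1 := hstep (-(n : ℤ) - 1)
    rw [sub_add_cancel, ih] at h1
    rw [zpow_sub_one₀ hμ]
    field_simp
    linarith

/-! ### Separation of image points by the fixed points of `γ_p` -/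

lemma isoCenter_real (g : Matrix.SpecialLinearGroup (Fin 2) ℝ) : ∃ c : ℝ, isoCenter g = c :=
  ⟨_, rfl⟩

lemma ne_of_mem_isoBall (hD : D.DisjointIsometricCircles) {u v : P₁ A × Bool} (huv : u ≠ v)
    {x y : ℂ} (hx : x ∈ D.isoBall u) (hy : y ∈ D.isoBall v) : x ≠ y := by
  rintro rfl
  exact Set.disjoint_left.mp (hD huv) (D.isoBall_subset _ hx) (D.isoBall_subset _ hy)

/-- Two real points of an isometric disc are not separated by a point outside it. -/
lemma mul_sub_pos_of_mem_isoBall {u : P₁ A × Bool} {x y a : ℝ} (hx : (x : ℂ) ∈ D.isoBall u)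
    (hy : (y : ℂ) ∈ D.isoBall u) (ha : (a : ℂ) ∉ D.isoBall u) : 0 < (x - a) * (y - a) := by
  obtain ⟨c, hc⟩ := isoCenter_real (D.letterSL u)
  simp only [isoBall, hc, Metric.mem_ball, Complex.dist_of_im_eq (Complex.ofReal_im _ |>.trans
    (Complex.ofReal_im _).symm), Complex.ofReal_re, Real.dist_eq, abs_lt] at hx hy ha
  rcases lt_trichotomy x a with h | h | h
  · rcases lt_or_ge y a with h' | h'
    · exact mul_pos_of_neg_of_neg (by linarith) (by linarith)
    · exact absurd ⟨by linarith [hx.1], by linarith [hy.2]⟩ ha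
  · exact absurd (h ▸ hx) ha
  · rcases lt_or_ge a y with h' | h'
    · exact mul_pos (by linarith) (by linarith)
    · exact absurd ⟨by linarith [hy.1], by linarith [hx.2]⟩ ha

lemma attr_notMem_isoBall (hD : D.DisjointIsometricCircles) {p : P₁ A} {u : P₁ A × Bool}
    (hu : u.1 ≠ p) : (D.attr p : ℂ) ∉ D.isoBall u := fun h =>
  ne_of_mem_isoBall hD (u := (p, false)) (v := u) (by rintro rfl; exact hu rfl)
    (D.attr_mem_isoBall p) h rfl

lemma rep_notMem_isoBall (hD : D.DisjointIsometricCircles) {p : P₁ A} {u : P₁ A × Bool}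
    (hu : u.1 ≠ p) : (D.rep p : ℂ) ∉ D.isoBall u := fun h =>
  ne_of_mem_isoBall hD (u := (p, true)) (v := u) (by rintro rfl; exact hu rfl)
    (D.rep_mem_isoBall p) h rfl

lemma cayR_ne_zero_of_mem_isoBall (hD : D.DisjointIsometricCircles) {p : P₁ A} {u : P₁ A × Bool}
    (hu : u.1 ≠ p) {x : ℝ} (hx : (x : ℂ) ∈ D.isoBall u) : x ≠ D.rep p ∧ D.cayR p x ≠ 0 := by
  have h1 : x ≠ D.rep p := by
    rintro rfl
    exact rep_notMem_isoBall hD hu hx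
  have h2 : x ≠ D.attr p := by
    rintro rfl
    exact attr_notMem_isoBall hD hu hx
  exact ⟨h1, div_ne_zero (sub_ne_zero.mpr h2) (sub_ne_zero.mpr h1)⟩

lemma cayR_mul_pos (hD : D.DisjointIsometricCircles) {p : P₁ A} {u : P₁ A × Bool} (hu : u.1 ≠ p)
    {x y : ℝ} (hx : (x : ℂ) ∈ D.isoBall u) (hy : (y : ℂ) ∈ D.isoBall u) :
    0 < D.cayR p x * D.cayR p y := by
  rw [cayR, cayR, div_mul_div_comm]
  exact div_pos (mul_sub_pos_of_mem_isoBall hx hy (attr_notMem_isoBall hD hu))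
    (mul_sub_pos_of_mem_isoBall hx hy (rep_notMem_isoBall hD hu))

lemma attrImg_ne_repImg (hD : D.DisjointIsometricCircles) (q : P₁ A) (γ : D.Gam) :
    D.attrImg q γ ≠ D.repImg q γ := by
  intro h
  have h1 := (attrImg_spec hD q γ).trans ((congrArg _ (congrArg _ h)).trans (repImg_spec hD q γ).symm)
  have h2 := OnePoint.coe_injective ((moebius γ).injective h1)
  exact (D.attr_lt_rep q).ne (by exact_mod_cast h2)

variable (D) in
/-- The data of a double coset in the coordinate of `γ_p`: the coordinates of
`γ(κ_{k,l})`, `γ(κ_{l,k})` are finite and nonzero. -/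
structure IsRegular (p q : P₁ A) (γ : D.Gam) : Prop where
  attr_ne : D.attrImg q γ ≠ D.rep p
  rep_ne : D.repImg q γ ≠ D.rep p
  cay_attr_ne : D.cayR p (D.attrImg q γ) ≠ 0
  cay_rep_ne : D.cayR p (D.repImg q γ) ≠ 0

lemma IsRegular.zpow_mul (hD : D.DisjointIsometricCircles) {p q : P₁ A} {γ : D.Gam}
    (h : D.IsRegular p q γ) (m : ℤ) : D.IsRegular p q (D.genG p ^ m * γ) := by
  obtain ⟨h1, h2⟩ := cayR_zpow_mul (attrImg_spec hD q) p h.attr_ne m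
  obtain ⟨h3, h4⟩ := cayR_zpow_mul (repImg_spec hD q) p h.rep_ne m
  have hμ := (zpow_pos (D.mult_pos p) m).ne'
  exact ⟨h1, h3, h2 ▸ mul_ne_zero hμ h.cay_attr_ne, h4 ▸ mul_ne_zero hμ h.cay_rep_ne⟩

/-- The crossing condition `κ_{k,l} < κ_{i,j} < κ_{l,k} < κ_{j,i}`. -/
def Crossing (D : Params A) (p q : P₁ A) : Prop :=
  D.attr q < D.attr p ∧ D.attr p < D.rep q ∧ D.rep q < D.rep p

/-- The coordinate `cayR p` is negative exactly between the fixed points of `γ_p`; `D.attr q < D.rep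
q` then excludes the side to the right of `D.rep p`. -/
lemma crossing_iff (p q : P₁ A) : D.Crossing p q ↔
    D.cayR p (D.rep q) < 0 ∧ 0 < D.cayR p (D.attr q) := by
  have hp := D.attr_lt_rep p
  have hq := D.attr_lt_rep q
  constructor
  · rintro ⟨h1, h2, h3⟩
    exact ⟨div_neg_of_pos_of_neg (by linarith) (by linarith),
      div_pos_of_neg_of_neg (by linarith) (by linarith)⟩
  · rintro ⟨h1, h2⟩
    have h3 : D.attr p < D.rep q ∧ D.rep q < D.rep p := by
      rcases div_neg_iff.mp h1 with ⟨a, b⟩ | ⟨a, b⟩ <;> constructor <;> linarith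
    refine ⟨?_, h3⟩
    rcases div_pos_iff.mp h2 with ⟨a, b⟩ | ⟨a, b⟩ <;> linarith [h3.1, h3.2]

lemma dcoset_mk_eq_one_iff (p q : P₁ A) (γ : D.Gam) :
    DoubleCoset.mk (D.cyc p) (D.cyc q) γ = DoubleCoset.mk (D.cyc p) (D.cyc q) 1 ↔
      ∃ j k : ℤ, γ = D.genG p ^ j * D.genG q ^ k := by
  rw [eq_comm, DoubleCoset.eq]
  constructor
  · rintro ⟨a, ha, b, hb, rfl⟩
    obtain ⟨j, rfl⟩ := Subgroup.mem_zpowers_iff.mp ha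
    obtain ⟨k, rfl⟩ := Subgroup.mem_zpowers_iff.mp hb
    exact ⟨j, k, by rw [mul_one]⟩
  · rintro ⟨j, k, rfl⟩
    exact ⟨_, Subgroup.mem_zpowers_iff.mpr ⟨j, rfl⟩, _, Subgroup.mem_zpowers_iff.mpr ⟨k, rfl⟩,
      by rw [mul_one]⟩

/-- Outside the identity double coset, the two points are not separated by the fixed points of
`γ_p`; in the identity double coset, they are powers of `γ_p` applied to the fixed points
of `γ_q`. -/
lemma isRegular_and_crossing (hD : D.DisjointIsometricCircles) (p q : P₁ A) (γ : D.Gam)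
    (hγ : ¬(p = q ∧ γ ∈ D.cyc p)) : D.IsRegular p q γ ∧
      (D.cayR p (D.repImg q γ) < 0 ∧ 0 < D.cayR p (D.attrImg q γ) ↔
        DoubleCoset.mk (D.cyc p) (D.cyc q) γ = DoubleCoset.mk (D.cyc p) (D.cyc q) 1 ∧
          D.Crossing p q) := by
  by_cases hone : ∃ j k : ℤ, γ = D.genG p ^ j * D.genG q ^ k
  · have hone' := (dcoset_mk_eq_one_iff p q γ).mpr hone
    obtain ⟨j, k, rfl⟩ := hone
    have hpq : q ≠ p := by
      rintro rfl
      exact hγ ⟨rfl, Subgroup.mem_zpowers_iff.mpr ⟨j + k, zpow_add _ _ _⟩⟩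
    have hreg : D.IsRegular p q 1 := by
      obtain ⟨h1, h2⟩ := cayR_ne_zero_of_mem_isoBall hD (u := (q, false)) hpq (D.attr_mem_isoBall q)
      obtain ⟨h3, h4⟩ := cayR_ne_zero_of_mem_isoBall hD (u := (q, true)) hpq (D.rep_mem_isoBall q)
      constructor
      · rwa [attrImg_one]
      · rwa [repImg_one]
      · rwa [attrImg_one]
      · rwa [repImg_one]
    have e1 : D.attrImg q (D.genG p ^ j * D.genG q ^ k) = D.attrImg q (D.genG p ^ j * 1) := by
      rw [attrImg_mul_zpow, mul_one]
    have e2 : D.repImg q (D.genG p ^ j * D.genG q ^ k) = D.repImg q (D.genG p ^ j * 1) := by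
      rw [repImg_mul_zpow, mul_one]
    have hreg' := hreg.zpow_mul hD j
    refine ⟨⟨e1 ▸ hreg'.1, e2 ▸ hreg'.2, e1 ▸ hreg'.3, e2 ▸ hreg'.4⟩, ?_⟩
    rw [e1, e2, (cayR_zpow_mul (attrImg_spec hD q) p hreg.attr_ne j).2,
      (cayR_zpow_mul (repImg_spec hD q) p hreg.rep_ne j).2, attrImg_one, repImg_one,
      crossing_iff, and_iff_right hone']
    have hμ := zpow_pos (D.mult_pos p) j
    rw [mul_pos_iff_of_pos_left hμ, ← neg_pos, ← mul_neg, mul_pos_iff_of_pos_left hμ, neg_pos]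
  · have hone' := mt (dcoset_mk_eq_one_iff p q γ).mp hone
    obtain ⟨L, m, k, h1, h2, h3, rfl⟩ := D.exists_word_doubleCoset p q γ
    obtain ⟨t, ht⟩ : ∃ t, t ∈ L.head? := by
      cases L with
      | nil => exact absurd ⟨m, k, by rw [word_nil, mul_one]⟩ hone
      | cons t L => exact ⟨t, rfl⟩
    have hu : (opp t).1 ≠ p := h3 t ht
    have hx := word_attrPt_mem hD h1 h2 t ht
    have hy := word_repPt_mem hD h1 h2 t ht
    rw [attrImg_spec hD, coe_mem_image_iff] at hx
    rw [repImg_spec hD, coe_mem_image_iff] at hy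
    obtain ⟨r1, r2⟩ := cayR_ne_zero_of_mem_isoBall hD hu hx
    obtain ⟨r3, r4⟩ := cayR_ne_zero_of_mem_isoBall hD hu hy
    have hreg : D.IsRegular p q (D.word L) := ⟨r1, r3, r2, r4⟩
    have hreg' := hreg.zpow_mul hD m
    have e1 := D.attrImg_mul_zpow q (D.genG p ^ m * D.word L) k
    have e2 := D.repImg_mul_zpow q (D.genG p ^ m * D.word L) k
    refine ⟨⟨e1 ▸ hreg'.1, e2 ▸ hreg'.2, e1 ▸ hreg'.3, e2 ▸ hreg'.4⟩, ?_⟩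
    refine iff_of_false ?_ fun h => hone' h.1
    rw [e1, e2, (cayR_zpow_mul (attrImg_spec hD q) p hreg.attr_ne m).2,
      (cayR_zpow_mul (repImg_spec hD q) p hreg.rep_ne m).2]
    rintro ⟨n1, n2⟩
    have hμ := zpow_pos (D.mult_pos p) m
    -- Both coordinates have the same sign, since one disc containing no fixed point of `γ_p` holds
    -- both points; the dilation by `μ ^ m` preserves signs.
    have hpos := mul_pos (mul_pos hμ hμ) (cayR_mul_pos hD hu hx hy)
    have := mul_neg_of_pos_of_neg n2 n1
    linarith

lemma periodRatio_eq (hD : D.DisjointIsometricCircles) {p q : P₁ A} {γ : D.Gam}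
    (hγ : ¬(p = q ∧ γ ∈ D.cyc p)) : D.periodRatio p q γ =
      (D.cayR p (D.attrImg q γ) : ℂ) / (D.cayR p (D.repImg q γ) : ℂ) := by
  rw [periodRatio, if_neg hγ, attrImg_spec hD, repImg_spec hD, ofReal_cayR, ofReal_cayR, cay, cay,
    div_div_div_eq]
  change ((D.attr p : ℂ) - D.attrImg q γ) * ((D.rep p : ℂ) - D.repImg q γ) /
    (((D.attr p : ℂ) - D.repImg q γ) * ((D.rep p : ℂ) - D.attrImg q γ)) = _
  congr 1 <;> ring

/-! ### Integrals of the terms of the series along a path from `a` to `γ_p(a)` -/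

variable (D) in
/-- The integral of a term of the Poincaré series along a path. -/
def pathTerm (q : P₁ A) (β : ℝ → ℂ) (c : D.Gam ⧸ D.cyc q) : ℂ :=
  ∫ t in (0 : ℝ)..1, D.seriesTerm q c (β t) * deriv β t

variable (D) in
/-- A path avoids the images of the fixed points of `γ_q`. -/
def Avoids (q : P₁ A) (β : ℝ → ℂ) : Prop :=
  ∀ t ∈ Icc (0 : ℝ) 1, ∀ γ : D.Gam, β t ≠ D.attrImg q γ ∧ β t ≠ D.repImg q γ

lemma pathTerm_mk (hD : D.DisjointIsometricCircles) {q : P₁ A} {β : ℝ → ℂ}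
    (hβ : IsIntegrationPath β) (hav : D.Avoids q β) (γ : D.Gam) :
    D.pathTerm q β (QuotientGroup.mk γ) =
      (∫ t in (0 : ℝ)..1, 1 / (β t - D.attrImg q γ) * deriv β t) -
        ∫ t in (0 : ℝ)..1, 1 / (β t - D.repImg q γ) * deriv β t := by
  simp only [pathTerm, seriesTerm_mk hD, sub_mul]
  exact intervalIntegral.integral_sub
    (hβ.intervalIntegrable_mul le_rfl zero_le_one le_rfl
      (hβ.continuousOn_inv fun t ht => (hav t ht γ).1))
    (hβ.intervalIntegrable_mul le_rfl zero_le_one le_rfl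
      (hβ.continuousOn_inv fun t ht => (hav t ht γ).2))

lemma exp_pathTerm (hD : D.DisjointIsometricCircles) {q : P₁ A} {β : ℝ → ℂ}
    (hβ : IsIntegrationPath β) (hav : D.Avoids q β) (γ : D.Gam) :
    Complex.exp (D.pathTerm q β (QuotientGroup.mk γ)) =
      ((β 1 - D.attrImg q γ) / (β 1 - D.repImg q γ)) /
        ((β 0 - D.attrImg q γ) / (β 0 - D.repImg q γ)) := by
  rw [pathTerm_mk hD hβ hav, Complex.exp_sub, hβ.exp_integral_inv fun t ht => (hav t ht γ).1,
    hβ.exp_integral_inv fun t ht => (hav t ht γ).2, div_div_div_comm]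

lemma pathTerm_of_upper (hD : D.DisjointIsometricCircles) {q : P₁ A} {β : ℝ → ℂ}
    (hβ : IsIntegrationPath β) (hav : D.Avoids q β) (hup : ∀ t ∈ Icc (0 : ℝ) 1, 0 < (β t).im)
    (γ : D.Gam) :
    D.pathTerm q β (QuotientGroup.mk γ) =
      Complex.log ((β 1 - D.attrImg q γ) / (β 1 - D.repImg q γ)) -
        Complex.log ((β 0 - D.attrImg q γ) / (β 0 - D.repImg q γ)) := by
  have h0 := hup 0 ⟨le_rfl, zero_le_one⟩
  have h1 := hup 1 ⟨zero_le_one, le_rfl⟩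
  rw [pathTerm_mk hD hβ hav, hβ.integral_inv_of_upper hup, hβ.integral_inv_of_upper hup,
    ← log_sub_log_of_upper (by simpa using h1) (by simpa using h1),
    ← log_sub_log_of_upper (by simpa using h0) (by simpa using h0)]
  ring

lemma avoids_of_upper {q : P₁ A} {β : ℝ → ℂ} (hup : ∀ t ∈ Icc (0 : ℝ) 1, 0 < (β t).im) :
    D.Avoids q β := by
  intro t ht γ
  constructor <;> intro h <;> have := hup t ht <;> rw [h] at this <;> simp at this

/-- A change of projective coordinate costs only a factor independent of `z`. -/
lemma sub_div_sub_eq_cay (p : P₁ A) {z : ℂ} {x y : ℝ} (hz : z ≠ D.rep p) (hx : x ≠ D.rep p)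
    (hy : y ≠ D.rep p) : (z - x) / (z - y) =
      (((x - D.rep p) / (y - D.rep p) : ℝ) : ℂ) *
        ((D.cay p z - D.cayR p x) / (D.cay p z - D.cayR p y)) := by
  have hz' : z - D.rep p ≠ 0 := sub_ne_zero.mpr hz
  have hx' : (x : ℂ) - D.rep p ≠ 0 := sub_ne_zero.mpr (by exact_mod_cast hx)
  have hy' : (y : ℂ) - D.rep p ≠ 0 := sub_ne_zero.mpr (by exact_mod_cast hy)
  have har : (D.attr p : ℂ) - D.rep p ≠ 0 := by
    exact_mod_cast (sub_neg.mpr (D.attr_lt_rep p)).ne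
  have key : ∀ w : ℂ, w - D.rep p ≠ 0 → D.cay p z - D.cay p w =
      (z - w) * (((D.attr p : ℂ) - D.rep p) / ((z - D.rep p) * (w - D.rep p))) := fun w hw => by
    rw [cay, cay, div_sub_div _ _ hz' hw, mul_div_assoc']
    congr 1
    ring
  have hquot : ∀ a b c d : ℂ, a ≠ 0 → b ≠ 0 → c ≠ 0 → d ≠ 0 →
      a / (b * c) / (a / (b * d)) = d / c := fun a b c d ha hb hc hd => by field_simp
  rw [ofReal_cayR, ofReal_cayR, key _ hx', key _ hy', mul_div_mul_comm,
    hquot _ _ _ _ har hz' hx' hy', mul_left_comm]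
  push_cast
  rw [div_mul_div_cancel₀ hy', div_self hx', mul_one]

lemma im_cay_neg (p : P₁ A) {z : ℂ} (hz : 0 < z.im) : (D.cay p z).im < 0 := by
  have hn : 0 < Complex.normSq (z - D.rep p) := Complex.normSq_pos.mpr fun h => by
    have := congrArg Complex.im h
    simp at this
    exact hz.ne' this
  rw [cay, Complex.div_im, ← sub_div]
  refine div_neg_of_neg_of_pos ?_ hn
  simp
  nlinarith [D.attr_lt_rep p]

lemma cayR_injective (p : P₁ A) {x y : ℝ} (hx : x ≠ D.rep p) (hy : y ≠ D.rep p)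
    (h : D.cayR p x = D.cayR p y) : x = y := by
  rw [cayR, cayR, div_eq_div_iff (sub_ne_zero.mpr hx) (sub_ne_zero.mpr hy)] at h
  have har : D.attr p - D.rep p ≠ 0 := (sub_neg.mpr (D.attr_lt_rep p)).ne
  refine mul_right_cancel₀ har ?_
  linear_combination h

/-- The ratios at the two ends of the path, for the `n`-th point of the orbit. -/
lemma ratio_orbit (hD : D.DisjointIsometricCircles) {p q : P₁ A} {γ : D.Gam}
    (hγ : D.IsRegular p q γ) {z w : ℂ} (hz : z ≠ D.rep p)
    (hzw : moebius (D.gen p) (z : OnePoint ℂ) = w) (n : ℤ) : ∃ k : ℝ, k ≠ 0 ∧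
      (z - D.attrImg q (D.genG p ^ n * γ)) / (z - D.repImg q (D.genG p ^ n * γ)) =
        k * orbitRatio (D.mult p) (D.cayR p (D.attrImg q γ)) (D.cayR p (D.repImg q γ))
          (D.cay p z) n ∧
      (w - D.attrImg q (D.genG p ^ n * γ)) / (w - D.repImg q (D.genG p ^ n * γ)) =
        k * orbitRatio (D.mult p) (D.cayR p (D.attrImg q γ)) (D.cayR p (D.repImg q γ))
          (D.cay p z) (n - 1) := by
  have hr := hγ.zpow_mul hD n
  obtain ⟨hw, hcay⟩ := cay_gen p hz hzw
  have e1 := (cayR_zpow_mul (attrImg_spec hD q) p hγ.attr_ne n).2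
  have e2 := (cayR_zpow_mul (repImg_spec hD q) p hγ.rep_ne n).2
  have hμ := (D.mult_pos p).ne'
  have hμc : (D.mult p : ℂ) ≠ 0 := by exact_mod_cast hμ
  -- The factor `k` depends only on the two orbit points, so it is the same at both ends of the path
  -- and cancels in the quotient.
  refine ⟨_, div_ne_zero (sub_ne_zero.mpr hr.attr_ne) (sub_ne_zero.mpr hr.rep_ne), ?_, ?_⟩
  · rw [sub_div_sub_eq_cay p hz hr.attr_ne hr.rep_ne, e1, e2]
    rfl
  · rw [sub_div_sub_eq_cay p hw hr.attr_ne hr.rep_ne, e1, e2, hcay, orbitRatio,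
      ← mul_div_mul_left (D.cay p z - _) _ hμc]
    -- The coordinate of `w` is `μ` times that of `z`; pulling `μ` out lowers the exponent by one,
    -- which is the telescoping shift.
    have key : ∀ X : ℝ, (D.mult p : ℂ) * (D.cay p z - ((D.mult p ^ (n - 1) * X : ℝ) : ℂ)) =
        D.mult p * D.cay p z - ((D.mult p ^ n * X : ℝ) : ℂ) := fun X => by
      rw [mul_sub, ← Complex.ofReal_mul, ← mul_assoc, ← zpow_one_add₀ hμ, add_sub_cancel]
    rw [key, key]

lemma exp_fiber (hD : D.DisjointIsometricCircles) {p q : P₁ A} {γ : D.Gam}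
    (hγ : D.IsRegular p q γ) {β : ℝ → ℂ} (hβ : D.JoinsByGen p β) (hav : D.Avoids q β)
    (ha : β 0 ≠ D.attr p) (hr : β 0 ≠ D.rep p) {F : ℂ}
    (hF : HasSum (fun n : ℤ => D.pathTerm q β (QuotientGroup.mk (D.genG p ^ n * γ))) F) :
    Complex.exp F = (D.cayR p (D.attrImg q γ) : ℂ) / (D.cayR p (D.repImg q γ) : ℂ) := by
  have h0 : (0 : ℝ) ∈ Icc (0 : ℝ) 1 := ⟨le_rfl, zero_le_one⟩
  refine telescope_exp (D.mult_pos p) (D.mult_lt_one p)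
    (div_ne_zero (sub_ne_zero.mpr ha) (sub_ne_zero.mpr hr)) hγ.cay_rep_ne (fun n => ?_) hF
    fun n => ?_
  · obtain ⟨k, hk, h1, -⟩ := ratio_orbit hD hγ hr hβ.endpoint n
    intro h
    rw [show D.cay p (β 0) = (β 0 - D.attr p) / (β 0 - D.rep p) from rfl] at h1
    rw [h, mul_zero, div_eq_zero_iff, sub_eq_zero, sub_eq_zero] at h1
    exact h1.elim (hav 0 h0 _).1 (hav 0 h0 _).2
  · obtain ⟨k, hk, h1, h2⟩ := ratio_orbit hD hγ hr hβ.endpoint n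
    rw [exp_pathTerm hD hβ.path hav, h1, h2, mul_div_mul_left _ _ (by exact_mod_cast hk)]
    rfl

lemma fiber_of_upper (hD : D.DisjointIsometricCircles) {p q : P₁ A} {γ : D.Gam}
    (hγ : D.IsRegular p q γ) {β : ℝ → ℂ} (hβ : D.JoinsByGen p β)
    (hup : ∀ t ∈ Icc (0 : ℝ) 1, 0 < (β t).im) {F : ℂ}
    (hF : HasSum (fun n : ℤ => D.pathTerm q β (QuotientGroup.mk (D.genG p ^ n * γ))) F) :
    F = Complex.log ((D.cayR p (D.attrImg q γ) : ℂ) / (D.cayR p (D.repImg q γ) : ℂ)) -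
      if D.cayR p (D.repImg q γ) < 0 ∧ 0 < D.cayR p (D.attrImg q γ) then 2 * π * I else 0 := by
  have h0 := hup 0 ⟨le_rfl, zero_le_one⟩
  have hr : β 0 ≠ D.rep p := by
    intro h
    rw [h] at h0
    simp at h0
  have him := im_cay_neg (D := D) p h0
  refine telescope_log (D.mult_pos p) (D.mult_lt_one p) him hγ.cay_attr_ne hγ.cay_rep_ne hF
    fun n => ?_
  obtain ⟨k, hk, h1, h2⟩ := ratio_orbit hD hγ hr hβ.endpoint n
  rw [pathTerm_of_upper hD hβ.path (avoids_of_upper hup) hup, h1, h2]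
  refine log_real_mul_sub ?_ hk
  have hne : D.cayR p (D.attrImg q γ) ≠ D.cayR p (D.repImg q γ) := fun h =>
    attrImg_ne_repImg hD q γ (cayR_injective p hγ.attr_ne hγ.rep_ne h)
  rcases lt_or_gt_of_ne hne with h | h
  · exact Or.inl ⟨im_orbitRatio_pos (D.mult_pos p) him h _, im_orbitRatio_pos (D.mult_pos p) him h _⟩
  · exact Or.inr ⟨im_orbitRatio_neg (D.mult_pos p) him h _, im_orbitRatio_neg (D.mult_pos p) him h _⟩

/-! ### Grouping the cosets into double cosets -/

variable (D) in
/-- The double coset of a coset. -/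
def dcosetOf (p q : P₁ A) (c : D.Gam ⧸ D.cyc q) : D.DCoset p q :=
  DoubleCoset.mk (D.cyc p) (D.cyc q) (D.word (D.repWord q c))

lemma dcosetOf_mk (p q : P₁ A) (γ : D.Gam) :
    D.dcosetOf p q (QuotientGroup.mk γ) = DoubleCoset.mk (D.cyc p) (D.cyc q) γ := by
  rw [dcosetOf, DoubleCoset.eq]
  have h := QuotientGroup.eq.mp (repWord_spec q (QuotientGroup.mk γ : D.Gam ⧸ D.cyc q)).2.2
  exact ⟨1, one_mem _, _, h, by group⟩

/-- The cosets in a regular double coset are the `γ_p^n γ`, without repetition: the nonzero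
coordinate of the image point is multiplied by `μ ^ n`, and `μ < 1`. -/
lemma hasSum_fiber (hD : D.DisjointIsometricCircles) {p q : P₁ A} {γ : D.Gam}
    (hγ : D.IsRegular p q γ) {T : D.Gam ⧸ D.cyc q → ℂ} (hT : Summable T) :
    HasSum (fun n : ℤ => T (QuotientGroup.mk (D.genG p ^ n * γ)))
      (∑' b : D.dcosetOf p q ⁻¹' {DoubleCoset.mk (D.cyc p) (D.cyc q) γ}, T b) := by
  have hmem : ∀ n : ℤ, (QuotientGroup.mk (D.genG p ^ n * γ) : D.Gam ⧸ D.cyc q) ∈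
      D.dcosetOf p q ⁻¹' {DoubleCoset.mk (D.cyc p) (D.cyc q) γ} := by
    intro n
    rw [Set.mem_preimage, Set.mem_singleton_iff, dcosetOf_mk, eq_comm, DoubleCoset.eq]
    exact ⟨_, Subgroup.mem_zpowers_iff.mpr ⟨n, rfl⟩, 1, one_mem _, by rw [mul_one]⟩
  have hbij : Function.Bijective fun n : ℤ =>
      (⟨_, hmem n⟩ : D.dcosetOf p q ⁻¹' {DoubleCoset.mk (D.cyc p) (D.cyc q) γ}) := by
    constructor
    · intro m n hmn
      have h1 := QuotientGroup.eq.mp (congrArg Subtype.val hmn)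
      obtain ⟨k, hk⟩ := Subgroup.mem_zpowers_iff.mp h1
      have h2 : D.genG p ^ n * γ = D.genG p ^ m * γ * D.genG q ^ k := by
        rw [hk]
        group
      have h3 : D.cayR p (D.attrImg q (D.genG p ^ n * γ)) =
          D.cayR p (D.attrImg q (D.genG p ^ m * γ)) := by
        rw [h2, attrImg_mul_zpow]
      rw [(cayR_zpow_mul (attrImg_spec hD q) p hγ.attr_ne n).2,
        (cayR_zpow_mul (attrImg_spec hD q) p hγ.attr_ne m).2] at h3
      exact (zpow_right_injective₀ (D.mult_pos p) (D.mult_lt_one p).ne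
        (mul_right_cancel₀ hγ.cay_attr_ne h3)).symm
    · rintro ⟨c, hc⟩
      obtain ⟨δ, rfl⟩ := QuotientGroup.mk_surjective c
      rw [Set.mem_preimage, Set.mem_singleton_iff, dcosetOf_mk, eq_comm, DoubleCoset.eq] at hc
      obtain ⟨a, ha, b, hb, rfl⟩ := hc
      obtain ⟨n, rfl⟩ := Subgroup.mem_zpowers_iff.mp ha
      refine ⟨n, Subtype.ext (QuotientGroup.eq.mpr ?_)⟩
      simpa [mul_assoc] using hb
  exact (Equiv.ofBijective _ hbij).hasSum_iff.mpr (hT.subtype _).hasSum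

/-- Here the double coset is the subgroup `⟨γ_p⟩` itself, a single coset, so nothing telescopes.
This is the origin of the exceptional value `μ`. -/
lemma fiber_of_degenerate {p q : P₁ A} {γ : D.Gam} (hγ : p = q ∧ γ ∈ D.cyc p)
    (T : D.Gam ⧸ D.cyc q → ℂ) :
    ∑' b : D.dcosetOf p q ⁻¹' {DoubleCoset.mk (D.cyc p) (D.cyc q) γ}, T b =
      T (QuotientGroup.mk 1) := by
  obtain ⟨rfl, hγ⟩ := hγ
  have hset : D.dcosetOf p p ⁻¹' {DoubleCoset.mk (D.cyc p) (D.cyc p) γ} =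
      {(QuotientGroup.mk 1 : D.Gam ⧸ D.cyc p)} := by
    ext c
    obtain ⟨δ, rfl⟩ := QuotientGroup.mk_surjective c
    rw [Set.mem_preimage, Set.mem_singleton_iff, Set.mem_singleton_iff, dcosetOf_mk, eq_comm,
      DoubleCoset.eq, eq_comm, QuotientGroup.eq, inv_one, one_mul]
    constructor
    · rintro ⟨a, ha, b, hb, rfl⟩
      exact mul_mem (mul_mem ha hγ) hb
    · intro h
      exact ⟨1, one_mem _, γ⁻¹ * δ, mul_mem (inv_mem hγ) h, by group⟩
  rw [hset]
  exact tsum_singleton _ T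

/-- With a single term, the exponential is the quotient of the `cay` coordinates at the two ends of
the path. -/
lemma exp_degenerate (hD : D.DisjointIsometricCircles) {p : P₁ A} {β : ℝ → ℂ}
    (hβ : D.JoinsByGen p β) (hav : D.Avoids p β) :
    Complex.exp (D.pathTerm p β (QuotientGroup.mk 1)) = D.mult p := by
  have h0 : (0 : ℝ) ∈ Icc (0 : ℝ) 1 := ⟨le_rfl, zero_le_one⟩
  obtain ⟨ha, hr⟩ := hav 0 h0 1
  rw [attrImg_one] at ha
  rw [repImg_one] at hr
  rw [exp_pathTerm hD hβ.path hav, attrImg_one, repImg_one]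
  have := (cay_gen p hr hβ.endpoint).2
  rw [cay, cay] at this
  rw [this, mul_div_assoc, div_self (div_ne_zero (sub_ne_zero.mpr ha) (sub_ne_zero.mpr hr)), mul_one]

lemma degenerate_of_upper (hD : D.DisjointIsometricCircles) {p : P₁ A} {β : ℝ → ℂ}
    (hβ : D.JoinsByGen p β) (hup : ∀ t ∈ Icc (0 : ℝ) 1, 0 < (β t).im) :
    D.pathTerm p β (QuotientGroup.mk 1) = Complex.log (D.mult p) := by
  have h0 : (0 : ℝ) ∈ Icc (0 : ℝ) 1 := ⟨le_rfl, zero_le_one⟩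
  have hav := avoids_of_upper (D := D) (q := p) hup
  obtain ⟨ha, hr⟩ := hav 0 h0 1
  rw [attrImg_one] at ha
  rw [repImg_one] at hr
  rw [pathTerm_of_upper hD hβ.path hav hup, attrImg_one, repImg_one]
  have := (cay_gen p hr hβ.endpoint).2
  rw [cay, cay] at this
  rw [this, Complex.log_ofReal_mul (D.mult_pos p)
    (div_ne_zero (sub_ne_zero.mpr ha) (sub_ne_zero.mpr hr)), add_sub_cancel_right,
    Complex.ofReal_log (D.mult_pos p).le]

/-! ### The period formula -/

lemma exp_fiber_eq_periodRatio (hD : D.DisjointIsometricCircles) {p q : P₁ A} {β : ℝ → ℂ}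
    (hβ : D.JoinsByGen p β) (hav : D.Avoids q β) (ha : β 0 ≠ D.attr p) (hr : β 0 ≠ D.rep p)
    (hT : Summable (D.pathTerm q β)) (γ : D.Gam) :
    Complex.exp (∑' b : D.dcosetOf p q ⁻¹' {DoubleCoset.mk (D.cyc p) (D.cyc q) γ},
      D.pathTerm q β b) = D.periodRatio p q γ := by
  by_cases hγ : p = q ∧ γ ∈ D.cyc p
  · rw [fiber_of_degenerate hγ, periodRatio, if_pos hγ]
    obtain ⟨rfl, -⟩ := hγ
    exact exp_degenerate hD hβ hav
  · obtain ⟨hreg, -⟩ := isRegular_and_crossing hD p q γ hγ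
    rw [periodRatio_eq hD hγ]
    exact exp_fiber hD hreg hβ hav ha hr (hasSum_fiber hD hreg hT)

open Classical in
lemma fiber_eq_log_periodRatio (hD : D.DisjointIsometricCircles) {p q : P₁ A} {β : ℝ → ℂ}
    (hβ : D.JoinsByGen p β) (hup : ∀ t ∈ Icc (0 : ℝ) 1, 0 < (β t).im)
    (hT : Summable (D.pathTerm q β)) (γ : D.Gam) :
    ∑' b : D.dcosetOf p q ⁻¹' {DoubleCoset.mk (D.cyc p) (D.cyc q) γ}, D.pathTerm q β b =
      Complex.log (D.periodRatio p q γ) -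
        if DoubleCoset.mk (D.cyc p) (D.cyc q) γ = DoubleCoset.mk (D.cyc p) (D.cyc q) 1 then
          (if D.Crossing p q then 2 * π * I else 0) else 0 := by
  rw [← ite_and]
  by_cases hγ : p = q ∧ γ ∈ D.cyc p
  · rw [fiber_of_degenerate hγ, periodRatio, if_pos hγ]
    obtain ⟨rfl, -⟩ := hγ
    -- With `p = q` a crossing would require `D.attr p < D.attr p`.
    rw [if_neg fun h => lt_irrefl _ h.2.1, sub_zero]
    exact degenerate_of_upper hD hβ hup
  · obtain ⟨hreg, hiff⟩ := isRegular_and_crossing hD p q γ hγ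
    rw [periodRatio_eq hD hγ, fiber_of_upper hD hreg hβ hup (hasSum_fiber hD hreg hT)]
    simp only [hiff]

lemma hasSum_pathTerm (hD : D.DisjointIsometricCircles) {q : P₁ A} {β : ℝ → ℂ}
    (hβ : IsIntegrationPath β) {δ : ℝ} (hδ : 0 < δ) (h : ∀ t ∈ Icc (0 : ℝ) 1, ∀ γ : D.Gam,
      δ ≤ ‖β t - D.attrImg q γ‖ ∧ δ ≤ ‖β t - D.repImg q γ‖) :
    Summable (D.pathTerm q β) ∧
      pathIntegral (D.omega q) β = 1 / (2 * π * I) * ∑' c, D.pathTerm q β c := by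
  have hs := hasSum_integral_seriesTerm hD q zero_le_one hβ.continuousOn hβ.integrable hδ h
  refine ⟨hs.summable, ?_⟩
  change _ = 1 / (2 * π * I) * ∑' c, ∫ t in (0 : ℝ)..1, D.seriesTerm q c (β t) * deriv β t
  rw [hs.tsum_eq, pathIntegral, ← intervalIntegral.integral_const_mul]
  simp only [omega, mul_assoc]

lemma exists_dist_of_upper {q : P₁ A} {β : ℝ → ℂ} (hβ : IsIntegrationPath β)
    (hup : ∀ t ∈ Icc (0 : ℝ) 1, 0 < (β t).im) : ∃ δ : ℝ, 0 < δ ∧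
      ∀ t ∈ Icc (0 : ℝ) 1, ∀ γ : D.Gam, δ ≤ ‖β t - D.attrImg q γ‖ ∧ δ ≤ ‖β t - D.repImg q γ‖ := by
  obtain ⟨t₀, ht₀, hmin⟩ := isCompact_Icc.exists_isMinOn (nonempty_Icc.mpr (zero_le_one' ℝ))
    (Complex.continuous_im.comp_continuousOn hβ.continuousOn)
  refine ⟨(β t₀).im, hup t₀ ht₀, fun t ht γ => ?_⟩
  have h1 : (β t₀).im ≤ (β t).im := hmin ht
  have h2 : ∀ x : ℝ, (β t).im ≤ ‖β t - x‖ := fun x => by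
    have := (le_abs_self _).trans (Complex.abs_im_le_norm (β t - x))
    simpa using this
  exact ⟨h1.trans (h2 _), h1.trans (h2 _)⟩

/-- A straight path in the upper half-plane from `i` to `γ_p(i)`. -/
lemma exists_upper_path (D : Params A) (p : P₁ A) : ∃ β : ℝ → ℂ, D.JoinsByGen p β ∧
    ∀ t ∈ Icc (0 : ℝ) 1, 0 < (β t).im := by
  obtain ⟨w, hw, hm⟩ := moebius_upper (D.gen p) I (by simp)
  have hd : ∀ t : ℝ, HasDerivAt (fun t : ℝ => I + t * (w - I)) (w - I) t := fun t => by
    simpa using ((Complex.ofRealCLM.hasDerivAt (x := t)).mul_const (w - I)).const_add I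
  have hderiv : deriv (fun t : ℝ => I + t * (w - I)) = fun _ => w - I :=
    funext fun t => (hd t).deriv
  refine ⟨fun t => I + t * (w - I), ⟨⟨by fun_prop, ⟨∅, finite_empty, fun t _ =>
    (hd t).differentiableAt⟩, ?_⟩, by simpa using hm⟩, fun t ht => ?_⟩
  · rw [hderiv]
    exact intervalIntegrable_const
  · have : (I + (t : ℂ) * (w - I)).im = (1 - t) + t * w.im := by
      simp
      ring
    change 0 < (I + (t : ℂ) * (w - I)).im
    rw [this]
    rcases eq_or_lt_of_le ht.1 with h | h
    · rw [← h]
      simp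
    · have := mul_pos h hw
      linarith [ht.2]

/-- The fibre sums, for a system of representatives. -/
lemma hasSum_fibers {p q : P₁ A} {T : D.Gam ⧸ D.cyc q → ℂ} (hT : Summable T)
    (r : D.DCoset p q → D.Gam) (hr : ∀ c, DoubleCoset.mk (D.cyc p) (D.cyc q) (r c) = c) :
    HasSum (fun d => ∑' b : D.dcosetOf p q ⁻¹' {DoubleCoset.mk (D.cyc p) (D.cyc q) (r d)}, T b)
      (∑' c, T c) := by
  have := hT.hasSum.tsum_fiberwise (D.dcosetOf p q)
  refine (congrArg (HasSum · _) (funext fun d => ?_)).mp this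
  rw [hr d]

-- The crossing term occurs in one double coset only, so the summability of the grouped integrals
-- passes to the logarithms.
open Classical in
lemma hasSum_log_periodRatio (hD : D.DisjointIsometricCircles) {p q : P₁ A} {β : ℝ → ℂ}
    (hβ : D.JoinsByGen p β) (hup : ∀ t ∈ Icc (0 : ℝ) 1, 0 < (β t).im)
    (r : D.DCoset p q → D.Gam) (hr : ∀ c, DoubleCoset.mk (D.cyc p) (D.cyc q) (r c) = c) :
    HasSum (fun d => Complex.log (D.periodRatio p q (r d)))
      ((∑' c, D.pathTerm q β c) + if D.Crossing p q then 2 * π * I else 0) := by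
  obtain ⟨δ, hδ, h⟩ := exists_dist_of_upper (D := D) (q := q) hβ.path hup
  obtain ⟨hT, -⟩ := hasSum_pathTerm hD hβ.path hδ h
  have h1 := hasSum_fibers hT r hr
  simp only [fiber_eq_log_periodRatio hD hβ hup hT, hr] at h1
  have h2 := hasSum_ite_eq (DoubleCoset.mk (D.cyc p) (D.cyc q) 1 : D.DCoset p q)
    (if D.Crossing p q then 2 * π * I else 0)
  simpa using h1.add h2

end Params

end KPSchottky

end

/-! ### Assembly of the proposition -/

theorem mainTheorem2 {N M : ℕ} (A : Matrix (Fin N) (Fin M) ℝ) (hA : KPSchottky.IsTNN A)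
    (D : KPSchottky.Params A) (hD : D.DisjointIsometricCircles) (p q : KPSchottky.P₁ A) :
    -- the series defining `ω_q` converges absolutely and is holomorphic on `Ω(Γ_A)`
    (∀ z : ℂ, (z : OnePoint ℂ) ∈ KPSchottky.discontinuitySet D.Gam →
      Summable fun c => ‖D.seriesTerm q c z‖) ∧
    DifferentiableOn ℂ (D.omega q)
      {z : ℂ | (z : OnePoint ℂ) ∈ KPSchottky.discontinuitySet D.Gam} ∧
    -- the isometric circles lie in `Ω(Γ_A)`
    (∀ z ∈ Metric.sphere (KPSchottky.isoCenter (D.genSL p)) (KPSchottky.isoRadius (D.genSL p)),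
      (z : OnePoint ℂ) ∈ KPSchottky.discontinuitySet D.Gam) ∧
    (∀ z ∈ Metric.sphere (KPSchottky.isoCenter ((D.genSL p)⁻¹))
        (KPSchottky.isoRadius ((D.genSL p)⁻¹)),
      (z : OnePoint ℂ) ∈ KPSchottky.discontinuitySet D.Gam) ∧
    -- `a`-periods: `I(γ_p⁻¹)` counterclockwise, equivalently `I(γ_p)` clockwise
    (∮ z in C(KPSchottky.isoCenter ((D.genSL p)⁻¹), KPSchottky.isoRadius ((D.genSL p)⁻¹)),
      D.omega q z) = (if p = q then 1 else 0) ∧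
    -(∮ z in C(KPSchottky.isoCenter (D.genSL p), KPSchottky.isoRadius (D.genSL p)),
      D.omega q z) = (if p = q then 1 else 0) ∧
    -- `b`-periods, for any system `r` of representatives of the double cosets
    ∀ r : D.DCoset p q → D.Gam,
      (∀ c, DoubleCoset.mk (D.cyc p) (D.cyc q) (r c) = c) →
      (Summable fun c => ‖Complex.log (D.periodRatio p q (r c))‖) ∧
      (∀ β : ℝ → ℂ, D.IsBCycle p β → ∃ n : ℤ,
        KPSchottky.pathIntegral (D.omega q) β =
          1 / (2 * Real.pi * Complex.I) * ∑' c, Complex.log (D.periodRatio p q (r c)) + n) ∧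
      (∀ β : ℝ → ℂ, D.JoinsByGen p β → (∀ t ∈ Set.Icc (0 : ℝ) 1, 0 < (β t).im) →
        KPSchottky.pathIntegral (D.omega q) β =
          1 / (2 * Real.pi * Complex.I) * ∑' c, Complex.log (D.periodRatio p q (r c)) -
            (if D.attr q < D.attr p ∧ D.attr p < D.rep q ∧ D.rep q < D.rep p then 1 else 0)) := by
  obtain hp := KPSchottky.Params.sphere_subset_discontinuitySet hD
  refine ⟨fun z hz => ?_, KPSchottky.Params.differentiableOn_omega hD q,
    fun z hz => hp (p, true) hz, fun z hz => hp (p, false) hz, ?_, ?_, fun r hr => ?_⟩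
  · obtain ⟨δ, hδ, h⟩ := KPSchottky.Params.exists_dist_attrImg hD q hz
    exact KPSchottky.Params.summable_seriesTerm hD q hδ h
  · refine (KPSchottky.Params.circleIntegral_omega hD q (p, false)).trans ?_
    by_cases h : p = q
    · simp [h]
    · simp [h, Ne.symm h]
  · refine (congrArg Neg.neg (KPSchottky.Params.circleIntegral_omega hD q (p, true))).trans ?_
    by_cases h : p = q
    · simp [h]
    · simp [h, Ne.symm h]
  · obtain ⟨β₀, hβ₀, hup₀⟩ := KPSchottky.Params.exists_upper_path D p
    -- The logarithms do not involve a path, so one auxiliary path in the upper half-plane proves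
    -- their summability, which is then used for arbitrary paths.
    have hlog := (KPSchottky.Params.hasSum_log_periodRatio hD hβ₀ hup₀ r hr).summable
    refine ⟨hlog.norm, fun β hβ => ?_, fun β hβ hup => ?_⟩
    · have himg : ∀ z ∈ β '' Icc (0 : ℝ) 1,
          (z : OnePoint ℂ) ∈ KPSchottky.discontinuitySet D.Gam := by
        rintro _ ⟨t, ht, rfl⟩
        exact hβ.mem_disc t ht
      obtain ⟨δ, hδ, h⟩ := KPSchottky.Params.exists_dist_of_isCompact hD q
        (isCompact_Icc.image_of_continuousOn hβ.path.continuousOn) himg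
      replace h : ∀ t ∈ Icc (0 : ℝ) 1, ∀ γ : D.Gam,
          δ ≤ ‖β t - D.attrImg q γ‖ ∧ δ ≤ ‖β t - D.repImg q γ‖ :=
        fun t ht => h _ (mem_image_of_mem β ht)
      have hav : D.Avoids q β := fun t ht γ =>
        ⟨sub_ne_zero.mp (norm_pos_iff.mp (hδ.trans_le (h t ht γ).1)),
          sub_ne_zero.mp (norm_pos_iff.mp (hδ.trans_le (h t ht γ).2))⟩
      -- The bound `h` concerns the orbit of the fixed points of `γ_q`; the starting point must also
      -- avoid those of `γ_p`, for its `cay` coordinate to be finite and nonzero.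
      obtain ⟨ε, hε, h0⟩ := KPSchottky.Params.exists_dist_attrImg hD p
        (hβ.mem_disc 0 ⟨le_rfl, zero_le_one⟩)
      have ha : β 0 ≠ D.attr p := by
        have := sub_ne_zero.mp (norm_pos_iff.mp (hε.trans_le (h0 1).1))
        rwa [KPSchottky.Params.attrImg_one] at this
      have hb : β 0 ≠ D.rep p := by
        have := sub_ne_zero.mp (norm_pos_iff.mp (hε.trans_le (h0 1).2))
        rwa [KPSchottky.Params.repImg_one] at this
      obtain ⟨hT, hint⟩ := KPSchottky.Params.hasSum_pathTerm hD hβ.path hδ h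
      have hexp := KPSchottky.Params.exp_fiber_eq_periodRatio hD hβ.toJoinsByGen hav ha hb hT
      -- Exponentiating both sums gives infinite products with equal factors, hence equal values, so
      -- the sums differ by a multiple of `2πi`.
      have h1 := (KPSchottky.Params.hasSum_fibers hT r hr).cexp
      have h2 := hlog.hasSum.cexp
      have hfun : (Complex.exp ∘ fun d => ∑' b : D.dcosetOf p q ⁻¹'
          {DoubleCoset.mk (D.cyc p) (D.cyc q) (r d)}, D.pathTerm q β b) =
          Complex.exp ∘ fun d => Complex.log (D.periodRatio p q (r d)) := by
        funext d
        rw [Function.comp_apply, Function.comp_apply, hexp, Complex.exp_log]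
        -- The ratio is nonzero because it is an exponential.
        rw [← hexp]
        exact Complex.exp_ne_zero _
      rw [hfun] at h1
      obtain ⟨n, hn⟩ := Complex.exp_eq_exp_iff_exists_int.mp (h1.unique h2)
      refine ⟨n, ?_⟩
      have hpi := Complex.two_pi_I_ne_zero
      rw [hint, hn, mul_add, mul_left_comm, one_div_mul_cancel hpi, mul_one]
    · obtain ⟨δ, hδ, h⟩ := KPSchottky.Params.exists_dist_of_upper (D := D) (q := q) hβ.path hup
      obtain ⟨-, hint⟩ := KPSchottky.Params.hasSum_pathTerm hD hβ.path hδ h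
      have hs := (KPSchottky.Params.hasSum_log_periodRatio hD hβ hup r hr).tsum_eq
      have hpi := Complex.two_pi_I_ne_zero
      rw [hint, hs, mul_add]
      by_cases hc : D.Crossing p q
      · have hc' := hc
        rw [KPSchottky.Params.Crossing] at hc'
        rw [if_pos hc, if_pos hc', one_div_mul_cancel hpi, add_sub_cancel_right]
      · have hc' := hc
        rw [KPSchottky.Params.Crossing] at hc'
        rw [if_neg hc, if_neg hc', mul_zero, add_zero, sub_zero]
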